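/- Let $\sigma>0$ and let $p\ge 3$ be an integer. Let $(X_{i,j})_{1\le i\le j}$ be independent random variables such that the $X_{i,i}$ are centered real Gaussian variables of variance $\sigma^2$ and the $X_{i,j}$, $i<j$, are identically distributed and are - either centered real Gaussian variables of variance $1$, in which case we set $\beta=1$; - or standard complex Gaussian variables, that is, with independent real and imaginary parts, both centered real Gaussian of variance $\tfrac12$, in which case we set $\beta=2$. (In both cases $\mathbb E|X_{1,2}|^2=1$.) For $N\ge 1$ let $X(N)$ be the $N\times N$ Hermitian matrix whose entries on and above the diagonal are $(X_{i,j})_{1\le i\le j\le N}$, let $X_N=X(N)/\sqrt N$, and let $\mathrm{tr}_N=\frac1N\mathrm{tr}$ be the normalized trace. Define $J_p:\mathbb R\to[0,+\infty]$ as follows. If $p$ is even, $$J_p(x)=\begin{cases}\frac12\min\left(\frac1{\sigma^2},\frac\beta2\right)\left(x-C_{p/2}\right)^{2/p}&\text{if }x\ge C_{p/2},\\ +\infty&\text{otherwise,}\end{cases}$$ where $C_{p/2}$ is the $(p/2)$-th Catalan number; if $p$ is odd, $$J_p(x)=\frac12\min\left(\frac1{\sigma^2},\frac\beta2\right)|x|^{2/p}\qquad(x\in\mathbb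 R).$$ Then the sequence of random variables $(\mathrm{tr}_N X_N^p)_{N\ge1}$ satisfies a large deviations principle with speed $N^{1+2/p}$ and good rate function $J_p$. That is, all the level sets $\{x\in\mathbb R: J_p(x)\le t\}$, $t\in[0,+\infty)$, are compact, and for every Borel set $B\subset\mathbb R$, with interior $B^\circ$ and closure $\overline B$, $$-\inf_{B^\circ}J_p\le\liminf_{N\to\infty}\frac1{N^{1+2/p}}\log\mathbb P\left(\mathrm{tr}_N X_N^p\in B\right)\le\limsup_{N\to\infty}\frac1{N^{1+2/p}}\log\mathbb P\left(\mathrm{tr}_N X_N^p\in B\right)\le-\inf_{\overline B}J_p,$$ where $\log 0=-\infty$ and $\inf_\emptyset J_p=+\infty$. -/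

import Mathlib

open MeasureTheory ProbabilityTheory Filter Topology
open scoped NNReal ENNReal ComplexConjugate

noncomputable section

namespace GaussianTraceLDP

/-- A rate function on `𝓧`: a function `J : 𝓧 → [0, ∞]` that is lower semicontinuous, in the
sense that all its level sets `{J ≤ t}`, `t ∈ [0, ∞)`, are closed. -/
def IsRateFunction {𝓧 : Type*} [TopologicalSpace 𝓧] (J : 𝓧 → ℝ≥0∞) : Prop :=
  ∀ t : ℝ≥0, IsClosed {x | J x ≤ t}

/-- A rate function is good if all its level sets are compact. -/
def IsGoodRateFunction {𝓧 : Type*} [TopologicalSpace 𝓧] (J : 𝓧 → ℝ≥0∞) : Prop :=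
  IsRateFunction J ∧ ∀ t : ℝ≥0, IsCompact {x | J x ≤ t}

/-- The random variables `Z n`, defined on the probability space `(Ω, P)` and with values in `𝓧`,
satisfy a large deviations principle with speed `v` and rate function `J`. The logarithm is
extended-real valued, with `log 0 = -∞`, and the infimum over the empty set is `+∞`. -/
structure SatisfiesLDP {Ω 𝓧 : Type*} [MeasurableSpace Ω] [TopologicalSpace 𝓧]
    [MeasurableSpace 𝓧] [BorelSpace 𝓧] (P : Measure Ω) (Z : ℕ → Ω → 𝓧) (v : ℕ → ℝ)
    (J : 𝓧 → ℝ≥0∞) : Prop where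
  aemeasurable : ∀ n, AEMeasurable (Z n) P
  isRateFunction : IsRateFunction J
  speed_monotone : Monotone v
  speed_tendsto : Tendsto v atTop atTop
  lower_bound : ∀ B : Set 𝓧, MeasurableSet B →
    -((⨅ x ∈ interior B, J x : ℝ≥0∞) : EReal) ≤
      liminf (fun n => ((1 / v n : ℝ) : EReal) * ENNReal.log (P {ω | Z n ω ∈ B})) atTop
  upper_bound : ∀ B : Set 𝓧, MeasurableSet B →
    limsup (fun n => ((1 / v n : ℝ) : EReal) * ENNReal.log (P {ω | Z n ω ∈ B})) atTop ≤
      -((⨅ x ∈ closure B, J x : ℝ≥0∞) : EReal)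

/-- A Wigner matrix, given as an infinite Hermitian array `X i j` of random variables whose
`N × N` top-left corner is the matrix of size `N` (indices start at `0`): the entries on and above
the diagonal are independent, those on the diagonal are identically distributed (and real, by
Hermitian symmetry), those above the diagonal are identically distributed, and all of them are
centered with finite moments of every order. -/
structure IsWigner {Ω : Type*} [MeasurableSpace Ω] (P : Measure Ω)
    (X : ℕ → ℕ → Ω → ℂ) : Prop where
  hermitian : ∀ i j ω, X j i ω = conj (X i j ω)
  indep : iIndepFun (fun (k : {k : ℕ × ℕ // k.1 ≤ k.2}) => X k.1.1 k.1.2) P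
  ident_diag : ∀ i, IdentDistrib (X i i) (X 0 0) P P
  ident_offDiag : ∀ i j, i < j → IdentDistrib (X i j) (X 0 1) P P
  centered_diag : ∫ ω, X 0 0 ω ∂P = 0
  centered_offDiag : ∫ ω, X 0 1 ω ∂P = 0
  moments_diag : ∀ k : ℕ, Integrable (fun ω => ‖X 0 0 ω‖ ^ k) P
  moments_offDiag : ∀ k : ℕ, Integrable (fun ω => ‖X 0 1 ω‖ ^ k) P

/-- The complex-valued random variable `Y` is almost surely real, and is a centered real Gaussian
variable of variance `v`. -/
def IsRealGaussian {Ω : Type*} [MeasurableSpace Ω] (P : Measure Ω) (v : ℝ≥0)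
    (Y : Ω → ℂ) : Prop :=
  HasLaw (fun ω => (Y ω).re) (gaussianReal 0 v) P ∧ ∀ᵐ ω ∂P, (Y ω).im = 0

/-- `Y` is a standard complex Gaussian variable: its real and imaginary parts are independent
centered real Gaussian variables of variance `1 / 2`, so that `E|Y|² = 1`. -/
def IsStdComplexGaussian {Ω : Type*} [MeasurableSpace Ω] (P : Measure Ω) (Y : Ω → ℂ) : Prop :=
  HasLaw (fun ω => (Y ω).re) (gaussianReal 0 (1 / 2)) P ∧
  HasLaw (fun ω => (Y ω).im) (gaussianReal 0 (1 / 2)) P ∧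
  IndepFun (fun ω => (Y ω).re) (fun ω => (Y ω).im) P

/-- The normalized `N × N` matrix `X_N = X / √N`. -/
def normalizedMatrix {Ω : Type*} (X : ℕ → ℕ → Ω → ℂ) (N : ℕ) (ω : Ω) :
    Matrix (Fin N) (Fin N) ℂ :=
  Matrix.of fun i j => X i j ω / (Real.sqrt N : ℂ)

/-- The normalized trace `(1 / N) tr (X_N ^ p)`; since `X_N` is Hermitian the trace is real, and
it is read as a real number by taking its real part. -/
def traceMoment {Ω : Type*} (X : ℕ → ℕ → Ω → ℂ) (p N : ℕ) (ω : Ω) : ℝ :=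
  (1 / (N : ℝ)) * (Matrix.trace (normalizedMatrix X N ω ^ p)).re

/-- The rate function. For even `p` the number `p / 2` is an exact quotient, and `catalan (p / 2)`
is the corresponding Catalan number. -/
def rateFunction (σ : ℝ) (β p : ℕ) (x : ℝ) : ℝ≥0∞ :=
  if Even p then
    if (catalan (p / 2) : ℝ) ≤ x then
      ENNReal.ofReal
        (1 / 2 * min (1 / σ ^ 2) ((β : ℝ) / 2) *
          (x - (catalan (p / 2) : ℝ)) ^ (2 / (p : ℝ)))
    else ⊤
  else
    ENNReal.ofReal (1 / 2 * min (1 / σ ^ 2) ((β : ℝ) / 2) * |x| ^ (2 / (p : ℝ)))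

end GaussianTraceLDP

end

/-!
The trace `tr_N X_N ^ p` is studied as a function `T` of a standard Gaussian vector `g` indexed by
`Fin N × Fin N` (`gaussianMatrix`, `modelTrace`, `measure_traceMoment_eq`). Three facts determine
its large deviations.

*Typical points.* With probability at least `3 / 4` the trace is close to the `p`-th moment `c` of
the semicircle law, while the operator norm is at most a small power of `N`
(`eventually_exists_typical_set`). Both come from Wigner's theorem for the Gaussian ensembles, which
follows from Gaussian integration by parts: the expectations of products of traces satisfy a
recursion (`loop_equation`) whose limit is the recursion of the Catalan numbers. It is applied to
the invariant ensembles; a diagonal of another variance is a bounded Hilbert–Schmidt perturbation.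

*Shifts.* Adding to a typical matrix a matrix `H` of Hilbert–Schmidt norm `O(N ^ (1 / p))` changes
the trace of the `p`-th power by `tr H ^ p + o(N)`, because the mixed terms contain a factor of
small operator norm (`norm_trace_add_pow_sub_le`, `eventually_exists_typical_set_translate`; this
is where `3 ≤ p` enters). In addition `|tr H ^ p| ≤ ‖H‖_HS ^ p`, with equality for a rank-one `H`,
and `0 ≤ tr H ^ p` for even `p`.

*Cost.* With `κ = min (1 / σ ^ 2) (β / 2)`, a shift by `h` of the Gaussian vector moves the matrix
by at most `‖H‖_HS ^ 2 ≤ ‖h‖ ^ 2 / (κ N)`, and some rank-one directions attain this bound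
asymptotically: a single diagonal entry if `1 / σ ^ 2 ≤ β / 2`, the constant vector otherwise.

For the upper bound, if all the points of `{T ∈ B}` are at squared distance at least `r` from a
typical set, then Gaussian concentration gives `P(T ∈ B) ≤ C exp (- (1 - t) r / 2)` for every
`t ∈ (0, 1)` (`gaussian_measure_le_of_far`, a consequence of the Prékopa–Leindler inequality). Here
`r = κ R ^ 2 N ^ (1 + 2 / p)` whenever `B` is at positive distance from the values `c + s` with
`|s| ≤ R ^ p` (and `0 ≤ s` for even `p`), which form a level set of the rate function. For the lower
bound, translating the typical set along a rank-one direction costs a factor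
`exp (- ‖h‖ ^ 2 / 2) / 4` by the Cameron–Martin formula (`gaussian_measure_ge_of_translate`).
-/

namespace GaussianTraceLDP

/-! ### The Prékopa–Leindler inequality on the line -/

/-- Brunn–Minkowski on the line when the target set is an interval; no measurability is needed,
as the volume of a set is at most its diameter. -/
lemma volume_add_le_of_ordConnected {t : ℝ} (ht0 : 0 < t) (ht1 : t < 1) {U V W : Set ℝ}
    (hU : U.Nonempty) (hV : V.Nonempty) (hW : W.OrdConnected)
    (h : ∀ x ∈ U, ∀ y ∈ V, (1 - t) * x + t * y ∈ W) :
    ENNReal.ofReal (1 - t) * volume U + ENNReal.ofReal t * volume V ≤ volume W := by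
  have key : ∀ x ∈ U, ∀ x' ∈ U, ∀ y ∈ V, ∀ y' ∈ V,
      ENNReal.ofReal (1 - t) * edist x x' + ENNReal.ofReal t * edist y y' ≤ volume W := by
    intro x hx x' hx' y hy y' hy'
    wlog hxx : x ≤ x' generalizing x x'
    · rw [edist_comm]; exact this x' hx' x hx (le_of_not_ge hxx)
    wlog hyy : y ≤ y' generalizing y y'
    · rw [edist_comm y]; exact this y' hy' y hy (le_of_not_ge hyy)
    have hsub : Set.Icc ((1 - t) * x + t * y) ((1 - t) * x' + t * y') ⊆ W :=
      hW.out (h x hx y hy) (h x' hx' y' hy')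
    refine le_trans (le_of_eq ?_) (measure_mono hsub)
    rw [Real.volume_Icc, edist_dist, edist_dist, Real.dist_eq, Real.dist_eq,
      abs_sub_comm, abs_sub_comm y, abs_of_nonneg (sub_nonneg.2 hxx),
      abs_of_nonneg (sub_nonneg.2 hyy), ← ENNReal.ofReal_mul (by linarith),
      ← ENNReal.ofReal_mul ht0.le, ← ENNReal.ofReal_add]
    · congr 1; ring
    · exact mul_nonneg (by linarith) (by linarith)
    · exact mul_nonneg (by linarith) (by linarith)
  have h1 : ENNReal.ofReal (1 - t) ≠ 0 := by simpa using ht1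
  have h2 : ENNReal.ofReal t ≠ 0 := by simpa using ht0
  refine le_trans (add_le_add (mul_le_mul_right (Real.volume_le_diam U) _)
    (mul_le_mul_right (Real.volume_le_diam V) _)) ?_
  rw [Metric.ediam, Metric.ediam]
  simp only [ENNReal.mul_iSup]
  obtain ⟨x, hx⟩ := hU
  obtain ⟨y, hy⟩ := hV
  refine ENNReal.biSup_add_biSup_le' ⟨x, hx⟩ ⟨y, hy⟩ fun x hx y hy => ?_
  refine ENNReal.biSup_add_biSup_le' ⟨x, hx⟩ ⟨y, hy⟩ fun x' hx' y' hy' => ?_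
  exact key x hx x' hx' y hy y' hy'

/-- Prékopa–Leindler in additive form, for functions with supremum `1`, by integrating
Brunn–Minkowski over the superlevel sets. -/
lemma lintegral_add_le_of_sup_eq_one {t : ℝ} (ht0 : 0 < t) (ht1 : t < 1) {u v w : ℝ → ℝ}
    (hu : Measurable u) (hv : Measurable v) (hw : Measurable w)
    (hu0 : ∀ x, 0 ≤ u x) (hv0 : ∀ x, 0 ≤ v x) (hw0 : ∀ x, 0 ≤ w x)
    (hu1 : ∀ x, u x ≤ 1) (hv1 : ∀ x, v x ≤ 1)
    (hus : ∀ l < 1, ∃ x, l < u x) (hvs : ∀ l < 1, ∃ x, l < v x)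
    (hconv : ∀ l, 0 < l → {x | l ≤ w x}.OrdConnected)
    (h : ∀ l, 0 < l → ∀ x y, l < u x → l < v y → l ≤ w ((1 - t) * x + t * y)) :
    ENNReal.ofReal (1 - t) * (∫⁻ x, ENNReal.ofReal (u x)) +
      ENNReal.ofReal t * (∫⁻ x, ENNReal.ofReal (v x)) ≤ ∫⁻ x, ENNReal.ofReal (w x) := by
  have cut : ∀ f : ℝ → ℝ, (∀ x, f x ≤ 1) →
      ∫⁻ l in Set.Ioi (0 : ℝ), volume {a | l < f a} ≤
        ∫⁻ l in Set.Ioo (0 : ℝ) 1, volume {a | l < f a} := by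
    intro f hf
    rw [← lintegral_indicator measurableSet_Ioi, ← lintegral_indicator measurableSet_Ioo]
    refine lintegral_mono fun l => ?_
    by_cases hl : l ∈ Set.Ioo (0 : ℝ) 1
    · rw [Set.indicator_of_mem hl, Set.indicator_of_mem (show l ∈ Set.Ioi (0 : ℝ) from hl.1)]
    · rw [Set.indicator_of_notMem hl]
      by_cases h0 : l ∈ Set.Ioi (0 : ℝ)
      · rw [Set.indicator_of_mem h0]
        have : {a | l < f a} = ∅ := by
          ext a
          simp only [Set.mem_ofPred_eq, Set.mem_empty_iff_false, iff_false, not_lt]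
          refine (hf a).trans ?_
          by_contra hc
          exact hl ⟨h0, not_le.1 hc⟩
        simp [this]
      · rw [Set.indicator_of_notMem h0]
  have hmeas : ∀ f : ℝ → ℝ, Measurable fun l : ℝ => volume {a | l < f a} := fun f =>
    Antitone.measurable fun l l' hll => measure_mono fun a ha => lt_of_le_of_lt hll ha
  rw [lintegral_eq_lintegral_meas_lt volume (ae_of_all _ hu0) hu.aemeasurable,
    lintegral_eq_lintegral_meas_lt volume (ae_of_all _ hv0) hv.aemeasurable,
    lintegral_eq_lintegral_meas_le volume (ae_of_all _ hw0) hw.aemeasurable]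
  refine le_trans (add_le_add (mul_le_mul_right (cut u hu1) _)
    (mul_le_mul_right (cut v hv1) _)) ?_
  rw [← lintegral_const_mul _ (hmeas u), ← lintegral_const_mul _ (hmeas v),
    ← lintegral_add_left ((hmeas u).const_mul _)]
  refine le_trans ?_ (lintegral_mono_set (Set.Ioo_subset_Ioi_self : Set.Ioo (0 : ℝ) 1 ⊆ _))
  refine (setLIntegral_mono' measurableSet_Ioo fun l hl => ?_)
  exact volume_add_le_of_ordConnected ht0 ht1 (hus l hl.2) (hvs l hl.2) (hconv l hl.1)
    fun x hx y hy => h l hl.1 x y hx hy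

lemma ENNReal_geom_mean_le_arith_mean {t : ℝ} (ht0 : 0 < t) (ht1 : t < 1) (a b : ℝ≥0∞) :
    a ^ (1 - t) * b ^ t ≤ ENNReal.ofReal (1 - t) * a + ENNReal.ofReal t * b := by
  have h1 : ENNReal.ofReal (1 - t) ≠ 0 := by simpa using ht1
  have h2 : ENNReal.ofReal t ≠ 0 := by simpa using ht0
  by_cases ha : a = ⊤
  · simp [ha, ENNReal.mul_top h1]
  by_cases hb : b = ⊤
  · simp [hb, ENNReal.mul_top h2]
  lift a to ℝ≥0 using ha
  lift b to ℝ≥0 using hb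
  rw [← ENNReal.coe_rpow_of_nonneg _ (by linarith : (0:ℝ) ≤ 1 - t),
    ← ENNReal.coe_rpow_of_nonneg _ ht0.le, ENNReal.ofReal, ENNReal.ofReal]
  norm_cast
  refine NNReal.geom_mean_le_arith_mean2_weighted _ _ a b ?_ |>.trans' (le_of_eq ?_)
  · rw [← Real.toNNReal_add (by linarith) ht0.le]; simp
  · rw [Real.coe_toNNReal _ (by linarith), Real.coe_toNNReal _ ht0.le]

/-- The Prékopa–Leindler inequality on the line, for a bounded target whose superlevel sets are
intervals. -/
theorem prekopa_leindler {t : ℝ} (ht0 : 0 < t) (ht1 : t < 1) {u v : ℝ → ℝ≥0∞} {w : ℝ → ℝ}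
    (hu : Measurable u) (hv : Measurable v) (hw : Measurable w) (hw0 : ∀ x, 0 ≤ w x) {C : ℝ}
    (hwC : ∀ x, w x ≤ C) (hconv : ∀ l, 0 < l → {x | l ≤ w x}.OrdConnected)
    (h : ∀ x y, u x ^ (1 - t) * v y ^ t ≤ ENNReal.ofReal (w ((1 - t) * x + t * y))) :
    (∫⁻ x, u x) ^ (1 - t) * (∫⁻ x, v x) ^ t ≤ ∫⁻ x, ENNReal.ofReal (w x) := by
  have ht1' : 0 < 1 - t := by linarith
  set a := ⨆ x, u x with ha
  set b := ⨆ x, v x with hb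
  have hua : ∀ x, u x ≤ a := fun x => le_iSup u x
  have hvb : ∀ x, v x ≤ b := fun x => le_iSup v x
  by_cases ha0 : a = 0
  · have : ∀ x, u x = 0 := fun x => le_antisymm (ha0 ▸ hua x) bot_le
    simp [this, ENNReal.zero_rpow_of_pos ht1']
  by_cases hb0 : b = 0
  · have : ∀ x, v x = 0 := fun x => le_antisymm (hb0 ▸ hvb x) bot_le
    simp [this, ENNReal.zero_rpow_of_pos ht0]
  have hab : ∀ l m, l < a → m < b → l ^ (1 - t) * m ^ t ≤ ENNReal.ofReal C := by
    intro l m hl hm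
    obtain ⟨x, hx⟩ := lt_iSup_iff.1 hl
    obtain ⟨y, hy⟩ := lt_iSup_iff.1 hm
    exact (mul_le_mul' (ENNReal.rpow_le_rpow hx.le ht1'.le)
      (ENNReal.rpow_le_rpow hy.le ht0.le)).trans ((h x y).trans
        (ENNReal.ofReal_le_ofReal (hwC _)))
  have haT : a ≠ ⊤ := by
    intro haT
    obtain ⟨m, hm0, hm⟩ := exists_between (pos_iff_ne_zero.2 hb0)
    have hm0' : m ^ t ≠ 0 := by simp [hm0.ne', ht0.le]
    have hmT : m ^ t ≠ ⊤ := by simp [hm.ne_top, ht0.le]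
    have : ∀ l : ℝ≥0∞, l < a → l ≤ (ENNReal.ofReal C / m ^ t) ^ (1 - t)⁻¹ := by
      intro l hl
      rw [ENNReal.le_rpow_inv_iff ht1', ENNReal.le_div_iff_mul_le (Or.inl hm0') (Or.inl hmT)]
      exact hab l m hl hm
    have := le_of_forall_lt_imp_le_of_dense this
    rw [haT, top_le_iff, ENNReal.rpow_eq_top_iff_of_pos (by positivity)] at this
    exact ENNReal.div_ne_top ENNReal.ofReal_ne_top hm0' this
  have hbT : b ≠ ⊤ := by
    intro hbT
    obtain ⟨m, hm0, hm⟩ := exists_between (pos_iff_ne_zero.2 ha0)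
    have hm0' : m ^ (1 - t) ≠ 0 := by simp [hm0.ne', ht1.le]
    have hmT : m ^ (1 - t) ≠ ⊤ := by simp [hm.ne_top, ht1.le]
    have : ∀ l : ℝ≥0∞, l < b → l ≤ (ENNReal.ofReal C / m ^ (1 - t)) ^ t⁻¹ := by
      intro l hl
      rw [ENNReal.le_rpow_inv_iff ht0, ENNReal.le_div_iff_mul_le (Or.inl hm0') (Or.inl hmT),
        mul_comm]
      exact hab m l hm hl
    have := le_of_forall_lt_imp_le_of_dense this
    rw [hbT, top_le_iff, ENNReal.rpow_eq_top_iff_of_pos (by positivity)] at this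
    exact ENNReal.div_ne_top ENNReal.ofReal_ne_top hm0' this
  -- normalize `u` and `v` to have supremum one
  set A := a.toReal
  set B := b.toReal
  have hA : 0 < A := ENNReal.toReal_pos ha0 haT
  have hB : 0 < B := ENNReal.toReal_pos hb0 hbT
  have hAa : ENNReal.ofReal A = a := ENNReal.ofReal_toReal haT
  have hBb : ENNReal.ofReal B = b := ENNReal.ofReal_toReal hbT
  have huT : ∀ x, u x ≠ ⊤ := fun x => ne_top_of_le_ne_top haT (hua x)
  have hvT : ∀ x, v x ≠ ⊤ := fun x => ne_top_of_le_ne_top hbT (hvb x)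
  set m := A ^ (1 - t) * B ^ t with hm
  have hm0 : 0 < m := by positivity
  have hsup : ∀ {f : ℝ → ℝ≥0∞} {s : ℝ≥0∞}, s = ⨆ x, f x → s ≠ 0 → s ≠ ⊤ → (∀ x, f x ≠ ⊤) →
      ∀ l < 1, ∃ x, l < (f x).toReal / s.toReal := by
    intro f s hs hs0 hsT hfT l hl
    have hS : 0 < s.toReal := ENNReal.toReal_pos hs0 hsT
    have : ENNReal.ofReal (l * s.toReal) < s := by
      refine lt_of_lt_of_eq ((ENNReal.ofReal_lt_ofReal_iff hS).2 ?_) (ENNReal.ofReal_toReal hsT)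
      nlinarith
    rw [hs] at this
    obtain ⟨x, hx⟩ := lt_iSup_iff.1 this
    refine ⟨x, ?_⟩
    rw [lt_div_iff₀ hS]
    rw [← hs, ← ENNReal.ofReal_toReal (hfT x)] at hx
    exact (ENNReal.ofReal_lt_ofReal_iff'.1 hx).1
  have main := lintegral_add_le_of_sup_eq_one ht0 ht1 (u := fun x => (u x).toReal / A)
    (v := fun x => (v x).toReal / B) (w := fun x => w x / m) (hu.ennreal_toReal.div_const _)
    (hv.ennreal_toReal.div_const _) (hw.div_const _) (fun x => by positivity)
    (fun x => by positivity) (fun x => div_nonneg (hw0 x) hm0.le)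
    (fun x => (div_le_one hA).2 (ENNReal.toReal_mono haT (hua x)))
    (fun x => (div_le_one hB).2 (ENNReal.toReal_mono hbT (hvb x)))
    (hsup ha ha0 haT huT) (hsup hb hb0 hbT hvT)
    (fun l hl => by simpa only [le_div_iff₀ hm0] using hconv (l * m) (by positivity))
    (fun l hl x y hx hy => by
      rw [le_div_iff₀ hm0]
      rw [lt_div_iff₀ hA] at hx
      rw [lt_div_iff₀ hB] at hy
      have h1 := h x y
      rw [← ENNReal.ofReal_toReal (huT x), ← ENNReal.ofReal_toReal (hvT y),
        ENNReal.ofReal_rpow_of_nonneg ENNReal.toReal_nonneg ht1'.le,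
        ENNReal.ofReal_rpow_of_nonneg ENNReal.toReal_nonneg ht0.le,
        ← ENNReal.ofReal_mul (by positivity), ENNReal.ofReal_le_ofReal_iff (hw0 _)] at h1
      refine le_trans ?_ h1
      calc l * m = (l * A) ^ (1 - t) * (l * B) ^ t := by
            rw [Real.mul_rpow hl.le hA.le, Real.mul_rpow hl.le hB.le, hm]
            have : l = l ^ (1 - t) * l ^ t := by
              rw [← Real.rpow_add hl]; simp
            nth_rw 1 [this]; ring
        _ ≤ _ := by gcongr)
  have hdiv : ∀ (c : ℝ), 0 < c → ∀ f : ℝ → ℝ, ENNReal.ofReal c * ∫⁻ x, ENNReal.ofReal (f x / c) =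
      ∫⁻ x, ENNReal.ofReal (f x) := by
    intro c hc f
    rw [← lintegral_const_mul' _ _ ENNReal.ofReal_ne_top]
    refine lintegral_congr fun x => ?_
    rw [← ENNReal.ofReal_mul hc.le]
    congr 1
    field_simp
  have hU : ∫⁻ x, u x = ENNReal.ofReal A * ∫⁻ x, ENNReal.ofReal ((u x).toReal / A) := by
    rw [hdiv A hA]; exact lintegral_congr fun x => (ENNReal.ofReal_toReal (huT x)).symm
  have hV : ∫⁻ x, v x = ENNReal.ofReal B * ∫⁻ x, ENNReal.ofReal ((v x).toReal / B) := by
    rw [hdiv B hB]; exact lintegral_congr fun x => (ENNReal.ofReal_toReal (hvT x)).symm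
  rw [hU, hV, ← hdiv m hm0 w, ENNReal.mul_rpow_of_nonneg _ _ ht1'.le,
    ENNReal.mul_rpow_of_nonneg _ _ ht0.le, mul_mul_mul_comm, hm,
    ENNReal.ofReal_mul (by positivity), ENNReal.ofReal_rpow_of_nonneg hA.le ht1'.le,
    ENNReal.ofReal_rpow_of_nonneg hB.le ht0.le]
  gcongr
  exact (ENNReal_geom_mean_le_arith_mean ht0 ht1 _ _).trans main

/-! ### Sharp Gaussian concentration -/

/-- The functional form of concentration that tensorizes: `f` and `g` being coupled through the
cost `c`, the product of their integrals (with exponents `1 - t` and `t`) is at most one. -/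
def HasPrekopaProperty {E : Type*} [MeasurableSpace E] (t : ℝ) (μ : Measure E)
    (c : E → E → ℝ) : Prop :=
  ∀ f g : E → ℝ≥0∞, Measurable f → Measurable g →
    (∀ x y, f x ^ (1 - t) * g y ^ t ≤ ENNReal.ofReal (Real.exp (c x y))) →
    (∫⁻ x, f x ∂μ) ^ (1 - t) * (∫⁻ x, g x ∂μ) ^ t ≤ 1

lemma hasPrekopaProperty_gaussianReal {t : ℝ} (ht0 : 0 < t) (ht1 : t < 1) :
    HasPrekopaProperty t (gaussianReal 0 1) (fun x y => t * (1 - t) / 2 * (x - y) ^ 2) := by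
  intro f g hf hg hfg
  have hpdf : ∀ x, gaussianPDFReal 0 1 x = (√(2 * Real.pi))⁻¹ * Real.exp (-x ^ 2 / 2) := by
    intro x; simp [gaussianPDFReal]
  have hc : (0:ℝ) < (√(2 * Real.pi))⁻¹ := by positivity
  have key := prekopa_leindler ht0 ht1 (u := gaussianPDF 0 1 * f) (v := gaussianPDF 0 1 * g)
    (w := gaussianPDFReal 0 1) ((measurable_gaussianPDF 0 1).mul hf)
    ((measurable_gaussianPDF 0 1).mul hg) (measurable_gaussianPDFReal 0 1)
    (gaussianPDFReal_nonneg 0 1) (C := (√(2 * Real.pi))⁻¹)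
    (fun x => by
      rw [hpdf]
      exact mul_le_of_le_one_right hc.le (Real.exp_le_one_iff.2 (by nlinarith [sq_nonneg x])))
    (fun l hl => by
      refine ⟨fun x hx y hy z hz => ?_⟩
      simp only [Set.mem_ofPred_eq, hpdf] at *
      rcases le_total 0 z with h0 | h0
      · exact hy.trans (by gcongr; exact hz.2)
      · refine hx.trans ?_
        gcongr ?_ * Real.exp ?_
        nlinarith [hz.1])
    (fun x y => by
      simp only [Pi.mul_apply]
      rw [ENNReal.mul_rpow_of_nonneg _ _ (by linarith), ENNReal.mul_rpow_of_nonneg _ _ ht0.le,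
        mul_mul_mul_comm]
      refine (mul_le_mul_right (hfg x y) _).trans (le_of_eq ?_)
      rw [gaussianPDF, gaussianPDF,
        ENNReal.ofReal_rpow_of_nonneg (gaussianPDFReal_nonneg _ _ _) (by linarith),
        ENNReal.ofReal_rpow_of_nonneg (gaussianPDFReal_nonneg _ _ _) ht0.le,
        ← ENNReal.ofReal_mul (by have := gaussianPDFReal_nonneg 0 1 x; positivity),
        ← ENNReal.ofReal_mul (by
          have := gaussianPDFReal_nonneg 0 1 x; have := gaussianPDFReal_nonneg 0 1 y; positivity)]
      congr 1
      rw [hpdf, hpdf, hpdf, Real.mul_rpow hc.le (Real.exp_pos _).le,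
        Real.mul_rpow hc.le (Real.exp_pos _).le, mul_mul_mul_comm, ← Real.rpow_add hc,
        ← Real.exp_mul, ← Real.exp_mul, ← Real.exp_add, mul_assoc, ← Real.exp_add]
      simp only [sub_add_cancel, Real.rpow_one]
      congr 2
      ring)
  rw [gaussianReal_of_var_ne_zero _ one_ne_zero,
    lintegral_withDensity_eq_lintegral_mul _ (measurable_gaussianPDF 0 1) hf,
    lintegral_withDensity_eq_lintegral_mul _ (measurable_gaussianPDF 0 1) hg]
  refine key.trans (le_of_eq ?_)
  exact lintegral_gaussianPDFReal_eq_one 0 one_ne_zero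

lemma HasPrekopaProperty.prod {E F : Type*} [MeasurableSpace E] [MeasurableSpace F] {t : ℝ}
    (ht0 : 0 < t) (ht1 : t < 1) {μ : Measure E} {ν : Measure F} [SFinite μ] [SFinite ν]
    {c : E → E → ℝ} {d : F → F → ℝ} (hμ : HasPrekopaProperty t μ c)
    (hν : HasPrekopaProperty t ν d) :
    HasPrekopaProperty t (μ.prod ν) (fun x y => c x.1 y.1 + d x.2 y.2) := by
  intro f g hf hg hfg
  have ht1' : 0 < 1 - t := by linarith
  rw [lintegral_prod _ hf.aemeasurable, lintegral_prod _ hg.aemeasurable]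
  refine hμ _ _ hf.lintegral_prod_right' hg.lintegral_prod_right' fun x y => ?_
  have hmul :
      ENNReal.ofReal (Real.exp (-c x y / t)) ^ t * ENNReal.ofReal (Real.exp (c x y)) = 1 := by
    rw [ENNReal.ofReal_rpow_of_nonneg (Real.exp_pos _).le ht0.le, ← Real.exp_mul,
      ← ENNReal.ofReal_mul (Real.exp_pos _).le, ← Real.exp_add, div_mul_cancel₀ _ ht0.ne']
    simp
  have := hν (fun x' => f (x, x')) (fun y' => ENNReal.ofReal (Real.exp (-c x y / t)) * g (y, y'))
    (hf.comp measurable_prodMk_left) ((hg.comp measurable_prodMk_left).const_mul _)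
    fun x' y' => by
      rw [ENNReal.mul_rpow_of_nonneg _ _ ht0.le, mul_left_comm]
      refine (mul_le_mul_right (hfg (x, x') (y, y')) _).trans (le_of_eq ?_)
      simp only
      rw [Real.exp_add, ENNReal.ofReal_mul (Real.exp_pos _).le, ← mul_assoc, hmul, one_mul]
  rw [lintegral_const_mul' _ _ ENNReal.ofReal_ne_top,
    ENNReal.mul_rpow_of_nonneg _ _ ht0.le, mul_left_comm] at this
  calc _ = (ENNReal.ofReal (Real.exp (-c x y / t)) ^ t *
          ENNReal.ofReal (Real.exp (c x y))) * _ := by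
        rw [hmul, one_mul]
    _ ≤ ENNReal.ofReal (Real.exp (c x y)) * 1 := by
        rw [mul_comm (ENNReal.ofReal _ ^ t), mul_assoc]
        gcongr
    _ = _ := mul_one _

lemma HasPrekopaProperty.of_measurePreserving {E F : Type*} [MeasurableSpace E]
    [MeasurableSpace F] {t : ℝ} {μ : Measure E} {ν : Measure F} {c : E → E → ℝ} {d : F → F → ℝ}
    (hμ : HasPrekopaProperty t μ c) (e : E ≃ᵐ F) (he : MeasurePreserving e μ ν)
    (hcd : ∀ x y, d (e x) (e y) = c x y) : HasPrekopaProperty t ν d := by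
  intro f g hf hg hfg
  rw [← he.lintegral_comp hf, ← he.lintegral_comp hg]
  exact hμ _ _ (hf.comp e.measurable) (hg.comp e.measurable) fun x y => by
    rw [← hcd]; exact hfg _ _

lemma hasPrekopaProperty_pi_gaussianReal {t : ℝ} (ht0 : 0 < t) (ht1 : t < 1) (ι : Type*)
    [Fintype ι] : HasPrekopaProperty t (Measure.pi fun _ : ι => gaussianReal 0 1)
      (fun x y => t * (1 - t) / 2 * ∑ i, (x i - y i) ^ 2) := by
  have hfin : ∀ n : ℕ, HasPrekopaProperty t (Measure.pi fun _ : Fin n => gaussianReal 0 1)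
      (fun x y => t * (1 - t) / 2 * ∑ i, (x i - y i) ^ 2) := by
    intro n
    induction n with
    | zero =>
      intro f g hf hg hfg
      have hpi : (Measure.pi fun _ : Fin 0 => gaussianReal 0 1) = Measure.dirac default := by
        exact Measure.pi_of_empty _ _
      rw [hpi, lintegral_dirac' _ hf, lintegral_dirac' _ hg]
      simpa using hfg default default
    | succ n ih =>
      refine ((hasPrekopaProperty_gaussianReal ht0 ht1).prod ht0 ht1 ih).of_measurePreserving
        (MeasurableEquiv.piFinSuccAbove (fun _ : Fin (n + 1) => ℝ) 0).symm
        (measurePreserving_piFinSuccAbove (fun _ : Fin (n + 1) => gaussianReal 0 1) 0).symm ?_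
      intro x y
      simp [Fin.sum_univ_succ, MeasurableEquiv.piFinSuccAbove, mul_add]
  refine (hfin (Fintype.card ι)).of_measurePreserving
    (MeasurableEquiv.piCongrLeft (fun _ : ι => ℝ) (Fintype.equivFin ι).symm)
    (measurePreserving_piCongrLeft (fun _ : ι => gaussianReal 0 1) (Fintype.equivFin ι).symm) ?_
  intro x y
  congr 1
  rw [← (Fintype.equivFin ι).symm.sum_comp]
  refine Finset.sum_congr rfl fun i _ => ?_
  simp only [MeasurableEquiv.coe_piCongrLeft, Equiv.piCongrLeft_apply_apply]

/-- Gaussian concentration with the sharp exponential rate: a set at squared Euclidean distance at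
least `r` from a set of probability at least `1 / 2` has probability `O(exp (-(1 - t) r / 2))`, for
every `t ∈ (0, 1)`, with a constant that does not depend on the dimension. -/
theorem gaussian_measure_le_of_far {ι : Type*} [Fintype ι] {t : ℝ} (ht0 : 0 < t) (ht1 : t < 1)
    {A S : Set (ι → ℝ)} (hA : MeasurableSet A) (hS : MeasurableSet S) {r : ℝ}
    (hA2 : 1 / 2 ≤ (Measure.pi fun _ : ι => gaussianReal 0 1) A)
    (hfar : ∀ x ∈ A, ∀ y ∈ S, r ≤ ∑ i, (x i - y i) ^ 2) :
    (Measure.pi fun _ : ι => gaussianReal 0 1) S ≤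
      ENNReal.ofReal (2 ^ ((1 - t) / t) * Real.exp (-((1 - t) * r / 2))) := by
  set γ := Measure.pi fun _ : ι => gaussianReal 0 1
  have ht1' : 0 < 1 - t := by linarith
  have := hasPrekopaProperty_pi_gaussianReal ht0 ht1 ι (A.indicator 1)
    (S.indicator fun _ => ENNReal.ofReal (Real.exp ((1 - t) * r / 2)))
    (measurable_one.indicator hA) (measurable_const.indicator hS) (fun x y => by
      by_cases hx : x ∈ A
      · by_cases hy : y ∈ S
        · rw [Set.indicator_of_mem hx, Set.indicator_of_mem hy, Pi.one_apply, ENNReal.one_rpow,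
            one_mul, ENNReal.ofReal_rpow_of_nonneg (Real.exp_pos _).le ht0.le, ← Real.exp_mul]
          refine ENNReal.ofReal_le_ofReal (Real.exp_le_exp.2 ?_)
          have := mul_le_mul_of_nonneg_left (hfar x hx y hy)
            (by positivity : 0 ≤ t * (1 - t) / 2)
          linarith
        · simp [hy, ENNReal.zero_rpow_of_pos ht0]
      · simp [hx, ENNReal.zero_rpow_of_pos ht1'])
  rw [lintegral_indicator_one hA, lintegral_indicator_const hS] at this
  have h2 : (1 / 2 : ℝ≥0∞) ^ (1 - t) *
      (ENNReal.ofReal (Real.exp ((1 - t) * r / 2)) * γ S) ^ t ≤ 1 :=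
    (mul_le_mul_left (ENNReal.rpow_le_rpow hA2 ht1'.le) _).trans this
  have hST : γ S ≠ ⊤ := measure_ne_top _ _
  have hhalf : (1 / 2 : ℝ≥0∞) = ENNReal.ofReal (1 / 2) := by
    rw [ENNReal.ofReal_div_of_pos (by norm_num)]; simp
  rw [hhalf, ← ENNReal.ofReal_toReal hST, ← ENNReal.ofReal_mul (Real.exp_pos _).le,
    ENNReal.ofReal_rpow_of_nonneg (by norm_num) ht1'.le,
    ENNReal.ofReal_rpow_of_nonneg (by positivity) ht0.le, ← ENNReal.ofReal_mul (by positivity),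
    ← ENNReal.ofReal_one, ENNReal.ofReal_le_ofReal_iff zero_le_one] at h2
  rw [← ENNReal.ofReal_toReal hST]
  refine ENNReal.ofReal_le_ofReal ?_
  set s := (γ S).toReal
  have hs : 0 ≤ s := ENNReal.toReal_nonneg
  have h3 : (Real.exp ((1 - t) * r / 2) * s) ^ t ≤ 2 ^ (1 - t) := by
    rw [one_div, Real.inv_rpow (by norm_num), inv_mul_le_iff₀ (by positivity), mul_one] at h2
    exact h2
  have h4 : Real.exp ((1 - t) * r / 2) * s ≤ 2 ^ ((1 - t) / t) := by
    have := Real.rpow_le_rpow (by positivity) h3 (by positivity : 0 ≤ t⁻¹)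
    rwa [Real.rpow_rpow_inv (by positivity) ht0.ne', ← Real.rpow_mul (by norm_num),
      ← div_eq_mul_inv] at this
  rw [Real.exp_neg, ← div_eq_mul_inv, le_div_iff₀ (Real.exp_pos _), mul_comm]
  exact h4

/-! ### Translating the standard Gaussian measure -/

lemma gaussianReal_eq_withDensity (h : ℝ) :
    gaussianReal h 1 = (gaussianReal 0 1).withDensity
      (fun x => ENNReal.ofReal (Real.exp (h * x - h ^ 2 / 2))) := by
  rw [gaussianReal_of_var_ne_zero _ one_ne_zero, gaussianReal_of_var_ne_zero _ one_ne_zero,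
    ← withDensity_mul _ (measurable_gaussianPDF 0 1) (by fun_prop)]
  congr 1
  ext x
  rw [Pi.mul_apply, gaussianPDF, gaussianPDF, ← ENNReal.ofReal_mul (gaussianPDFReal_nonneg _ _ _)]
  congr 1
  simp only [gaussianPDFReal]
  simp only [NNReal.coe_one]
  rw [mul_assoc _ (Real.exp _), ← Real.exp_add]
  congr 2
  ring

lemma pi_gaussianReal_eq_withDensity {ι : Type*} [Fintype ι] (h : ι → ℝ) :
    (Measure.pi fun i => gaussianReal (h i) 1) =
      (Measure.pi fun _ : ι => gaussianReal 0 1).withDensity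
        (fun x => ENNReal.ofReal (Real.exp (∑ i, h i * x i - (∑ i, h i ^ 2) / 2))) := by
  have hfact : ∀ x : ι → ℝ, ENNReal.ofReal (Real.exp (∑ i, h i * x i - (∑ i, h i ^ 2) / 2)) =
      ∏ i, ENNReal.ofReal (Real.exp (h i * x i - h i ^ 2 / 2)) := by
    intro x
    rw [Finset.sum_div, ← Finset.sum_sub_distrib, Real.exp_sum,
      ENNReal.ofReal_prod_of_nonneg fun i _ => (Real.exp_pos _).le]
  refine Measure.pi_eq fun s hs => ?_
  rw [withDensity_apply _ (MeasurableSet.univ_pi hs), ← lintegral_indicator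
    (MeasurableSet.univ_pi hs)]
  have hind : ∀ x : ι → ℝ, (Set.univ.pi s).indicator (fun x : ι → ℝ => ENNReal.ofReal
      (Real.exp (∑ i, h i * x i - (∑ i, h i ^ 2) / 2))) x =
      ∏ i, (s i).indicator (fun y => ENNReal.ofReal (Real.exp (h i * y - h i ^ 2 / 2))) (x i) := by
    intro x
    by_cases hx : x ∈ Set.univ.pi s
    · rw [Set.indicator_of_mem hx, hfact]
      exact Finset.prod_congr rfl fun i _ =>
        (Set.indicator_of_mem (hx i (Set.mem_univ i))
          fun y => ENNReal.ofReal (Real.exp (h i * y - h i ^ 2 / 2))).symm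
    · rw [Set.indicator_of_notMem hx]
      simp only [Set.mem_pi, Set.mem_univ, forall_const, not_forall] at hx
      obtain ⟨i, hi⟩ := hx
      exact (Finset.prod_eq_zero (Finset.mem_univ i) (Set.indicator_of_notMem hi _)).symm
  have hm : ∀ i, Measurable ((s i).indicator
      (fun y => ENNReal.ofReal (Real.exp (h i * y - h i ^ 2 / 2)))) := fun i =>
    Measurable.indicator (by fun_prop) (hs i)
  simp_rw [hind]
  rw [lintegral_prod_eq_prod_lintegral_of_indepFun Finset.univ
    (fun i (x : ι → ℝ) => (s i).indicator
      (fun y => ENNReal.ofReal (Real.exp (h i * y - h i ^ 2 / 2))) (x i))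
    (iIndepFun_pi fun i => (hm i).aemeasurable) fun i => (hm i).comp (measurable_pi_apply i)]
  refine Finset.prod_congr rfl fun i _ => ?_
  rw [gaussianReal_eq_withDensity (h i), withDensity_apply _ (hs i), ← lintegral_indicator (hs i)]
  exact (measurePreserving_eval (fun _ : ι => gaussianReal 0 1) i).lintegral_comp (hm i)

lemma measurePreserving_neg_pi_gaussianReal {ι : Type*} [Fintype ι] :
    MeasurePreserving (fun x : ι → ℝ => -x) (Measure.pi fun _ : ι => gaussianReal 0 1)
      (Measure.pi fun _ : ι => gaussianReal 0 1) :=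
  measurePreserving_pi _ _ fun _ =>
    ⟨measurable_neg, (gaussianReal_map_neg (μ := 0) (v := 1)).trans (by rw [neg_zero])⟩

lemma measurePreserving_sub_pi_gaussianReal {ι : Type*} [Fintype ι] (h : ι → ℝ) :
    MeasurePreserving (fun x : ι → ℝ => x - h) (Measure.pi fun _ : ι => gaussianReal 0 1)
      (Measure.pi fun i => gaussianReal (-h i) 1) :=
  measurePreserving_pi _ _ fun i =>
    ⟨measurable_id.sub_const _, by simpa using gaussianReal_map_sub_const (μ := 0) (v := 1) (h i)⟩

/-- Cameron–Martin lower bound: if the translate by `h` of a set of probability at least `3 / 4`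
is contained in `S`, then the probability of `S` is at least `exp (-|h|² / 2) / 4`. By symmetry,
half of the space sees a density at least `exp (-|h|² / 2)`. -/
theorem gaussian_measure_ge_of_translate {ι : Type*} [Fintype ι] (h : ι → ℝ) {A S : Set (ι → ℝ)}
    (hA : MeasurableSet A) (hS : MeasurableSet S)
    (hA2 : 3 / 4 ≤ (Measure.pi fun _ : ι => gaussianReal 0 1).real A)
    (hAS : ∀ x ∈ A, x + h ∈ S) :
    1 / 4 * Real.exp (-(∑ i, h i ^ 2) / 2) ≤ (Measure.pi fun _ : ι => gaussianReal 0 1).real S := by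
  set γ := Measure.pi fun _ : ι => gaussianReal 0 1
  have hlin : Measurable fun x : ι → ℝ => ∑ i, h i * x i := by fun_prop
  set H : Set (ι → ℝ) := {x | ∑ i, h i * x i ≤ 0}
  have hH : MeasurableSet H := measurableSet_le hlin measurable_const
  have hHalf : 1 / 2 ≤ γ.real H := by
    have h1 : γ.real Hᶜ = γ.real {x | ∑ i, h i * x i < 0} := by
      rw [← measurePreserving_neg_pi_gaussianReal.measureReal_preimage
        (measurableSet_lt hlin measurable_const).nullMeasurableSet]
      congr 1
      ext x
      simp [H]
    have h2 : γ.real {x | ∑ i, h i * x i < 0} ≤ γ.real H :=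
      measureReal_mono fun x (hx : _ < _) => le_of_lt (α := ℝ) hx
    have h3 := probReal_compl_eq_one_sub (μ := γ) hH
    linarith
  have hAH : 1 / 4 ≤ γ.real (A ∩ H) := by
    have h1 := measureReal_union_add_inter (μ := γ) (s := A) hH
    have h2 : γ.real (A ∪ H) ≤ 1 := measureReal_le_one
    linarith
  have hT : MeasurableSet {x : ι → ℝ | x + h ∈ S} := (measurable_id.add_const h) hS
  have hSeq : γ S = (Measure.pi fun i => gaussianReal (-h i) 1) {x | x + h ∈ S} := by
    rw [← (measurePreserving_sub_pi_gaussianReal h).measure_preimage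
      hT.nullMeasurableSet]
    congr 1
    ext x
    simp
  have hle : ENNReal.ofReal (Real.exp (-(∑ i, h i ^ 2) / 2)) * γ (A ∩ H) ≤ γ S := by
    rw [hSeq, pi_gaussianReal_eq_withDensity fun i => -h i,
      withDensity_apply _ hT, ← setLIntegral_const]
    refine (setLIntegral_mono' (hA.inter hH) fun x hx => ?_).trans
      (lintegral_mono_set fun x hx => hAS x hx.1)
    refine ENNReal.ofReal_le_ofReal (Real.exp_le_exp.2 ?_)
    have hx2 : ∑ i, h i * x i ≤ 0 := hx.2
    simp only [neg_mul, Finset.sum_neg_distrib, neg_sq]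
    linarith
  have := ENNReal.toReal_mono (measure_ne_top γ S) hle
  rw [ENNReal.toReal_mul, ENNReal.toReal_ofReal (Real.exp_pos _).le] at this
  refine le_trans ?_ this
  rw [mul_comm]
  gcongr
  exact hAH

/-! ### Traces of powers of a perturbed matrix -/

section Trace

set_option linter.unusedSectionVars false

open scoped Matrix Matrix.Norms.L2Operator

variable {n : Type*} [Fintype n] [DecidableEq n]

/-- The Hilbert–Schmidt norm. It is a plain function, because the operator norm is the norm in
force on matrices. -/
noncomputable def hsNorm (A : Matrix n n ℂ) : ℝ := √(∑ i, ∑ j, ‖A i j‖ ^ 2)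

lemma hsNorm_nonneg (A : Matrix n n ℂ) : 0 ≤ hsNorm A := Real.sqrt_nonneg _

lemma hsNorm_sq (A : Matrix n n ℂ) : hsNorm A ^ 2 = ∑ i, ∑ j, ‖A i j‖ ^ 2 :=
  Real.sq_sqrt (by positivity)

lemma hsNorm_eq_frobenius (A : Matrix n n ℂ) :
    hsNorm A = Matrix.frobeniusNormedAddCommGroup.toNorm.norm A := by
  rw [Matrix.frobenius_norm_def, hsNorm, Real.sqrt_eq_rpow]
  norm_cast

lemma hsNorm_add_le (A B : Matrix n n ℂ) : hsNorm (A + B) ≤ hsNorm A + hsNorm B := by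
  simp only [hsNorm_eq_frobenius]
  exact @norm_add_le _
    (Matrix.frobeniusNormedAddCommGroup).toSeminormedAddCommGroup.toSeminormedAddGroup A B

lemma hsNorm_mul_le (A B : Matrix n n ℂ) : hsNorm (A * B) ≤ hsNorm A * hsNorm B := by
  simp only [hsNorm_eq_frobenius]
  exact Matrix.frobenius_norm_mul A B

lemma hsNorm_conjTranspose (A : Matrix n n ℂ) : hsNorm Aᴴ = hsNorm A := by
  simp only [hsNorm, Matrix.conjTranspose_apply, norm_star]
  rw [Finset.sum_comm]

lemma hsNorm_one : hsNorm (1 : Matrix n n ℂ) = √(Fintype.card n) := by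
  simp [hsNorm, Matrix.one_apply, apply_ite]

lemma hsNorm_smul (c : ℂ) (A : Matrix n n ℂ) : hsNorm (c • A) = ‖c‖ * hsNorm A := by
  simp only [hsNorm, Matrix.smul_apply, smul_eq_mul, norm_mul, mul_pow, ← Finset.mul_sum]
  rw [Real.sqrt_mul (by positivity), Real.sqrt_sq (norm_nonneg _)]

lemma norm_trace_mul_le (A B : Matrix n n ℂ) : ‖(A * B).trace‖ ≤ hsNorm A * hsNorm B := by
  rw [← hsNorm_conjTranspose B]
  simp only [hsNorm, ← Finset.sum_product', Finset.univ_product_univ, Matrix.trace,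
    Matrix.diag_apply, Matrix.mul_apply, Matrix.conjTranspose_apply, norm_star]
  refine (norm_sum_le _ _).trans ((Finset.sum_le_sum fun p _ =>
    (norm_mul_le (A p.1 p.2) (B p.2 p.1))).trans ?_)
  exact Real.sum_mul_le_sqrt_mul_sqrt _ _ _

lemma hsNorm_mul_le_opNorm_mul (A B : Matrix n n ℂ) : hsNorm (A * B) ≤ ‖A‖ * hsNorm B := by
  refine abs_le_of_sq_le_sq' ?_ (by have := hsNorm_nonneg B; positivity) |>.2
  rw [mul_pow, hsNorm_sq, hsNorm_sq, Finset.sum_comm, Finset.sum_comm (f := fun i j => ‖B i j‖ ^ 2),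
    Finset.mul_sum]
  refine Finset.sum_le_sum fun j _ => ?_
  have := Matrix.l2_opNorm_mulVec A (WithLp.toLp 2 fun i => B i j)
  have h2 := pow_le_pow_left₀ (norm_nonneg _) this 2
  rw [mul_pow, EuclideanSpace.norm_sq_eq, EuclideanSpace.norm_sq_eq] at h2
  exact h2

lemma hsNorm_mul_le_mul_opNorm (A B : Matrix n n ℂ) : hsNorm (A * B) ≤ hsNorm A * ‖B‖ := by
  rw [← hsNorm_conjTranspose, Matrix.conjTranspose_mul, mul_comm, ← hsNorm_conjTranspose A,
    ← Matrix.l2_opNorm_conjTranspose B]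
  exact hsNorm_mul_le_opNorm_mul _ _

lemma opNorm_le_hsNorm (A : Matrix n n ℂ) : ‖A‖ ≤ hsNorm A := by
  rw [Matrix.l2_opNorm_def]
  refine ContinuousLinearMap.opNorm_le_bound _ (hsNorm_nonneg A) fun x => ?_
  refine abs_le_of_sq_le_sq' ?_ (by have := hsNorm_nonneg A; positivity) |>.2
  rw [mul_pow, hsNorm_sq, EuclideanSpace.norm_sq_eq, EuclideanSpace.norm_sq_eq, Finset.sum_mul]
  refine Finset.sum_le_sum fun i _ => ?_
  have h1 : ‖∑ j, A i j * x j‖ ≤ ∑ j, ‖A i j‖ * ‖x j‖ :=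
    (norm_sum_le _ _).trans (Finset.sum_le_sum fun j _ => norm_mul_le _ _)
  exact (pow_le_pow_left₀ (norm_nonneg _) h1 2).trans (Finset.sum_mul_sq_le_sq_mul_sq _ _ _)

lemma hsNorm_pow_le (H : Matrix n n ℂ) (k : ℕ) : hsNorm (H ^ (k + 1)) ≤ hsNorm H ^ (k + 1) := by
  induction k with
  | zero => simp
  | succ k ih =>
    rw [pow_succ, pow_succ _ (k + 1)]
    exact (hsNorm_mul_le _ _).trans (mul_le_mul_of_nonneg_right ih (hsNorm_nonneg H))

lemma hsNorm_mul_pow_le (A Y : Matrix n n ℂ) (k : ℕ) : hsNorm (A * Y ^ k) ≤ hsNorm A * ‖Y‖ ^ k := by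
  induction k with
  | zero => simp
  | succ k ih =>
    rw [pow_succ, ← mul_assoc, pow_succ, ← mul_assoc]
    exact (hsNorm_mul_le_mul_opNorm _ _).trans (mul_le_mul_of_nonneg_right ih (norm_nonneg Y))

lemma hsNorm_pow_le_card (Y : Matrix n n ℂ) (k : ℕ) :
    hsNorm (Y ^ k) ≤ √(Fintype.card n) * ‖Y‖ ^ k := by
  have := hsNorm_mul_pow_le 1 Y k
  rwa [one_mul, hsNorm_one] at this

/-- The trace of a power at least two is controlled by the Hilbert–Schmidt norm alone. -/
lemma norm_trace_pow_le (H : Matrix n n ℂ) (k : ℕ) :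
    ‖(H ^ (k + 2)).trace‖ ≤ hsNorm H ^ (k + 2) := by
  rw [pow_succ, pow_succ (hsNorm H)]
  exact (norm_trace_mul_le _ _).trans
    (mul_le_mul_of_nonneg_right (hsNorm_pow_le H k) (hsNorm_nonneg H))

lemma re_trace_pow_two_mul {H : Matrix n n ℂ} (hH : H.IsHermitian) (k : ℕ) :
    ((H ^ (2 * k)).trace).re = hsNorm (H ^ k) ^ 2 := by
  have hk : (H ^ k)ᴴ = H ^ k := (hH.pow k)
  rw [two_mul, pow_add, hsNorm_sq]
  nth_rw 2 [← hk]
  simp only [Matrix.trace, Matrix.diag_apply, Matrix.mul_apply, Matrix.conjTranspose_apply,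
    Complex.re_sum]
  refine Finset.sum_congr rfl fun i _ => Finset.sum_congr rfl fun j _ => ?_
  rw [← starRingEnd_apply, Complex.mul_conj, Complex.normSq_eq_norm_sq, Complex.ofReal_re]

lemma opNorm_pow_le_trace {Y : Matrix n n ℂ} (hY : Y.IsHermitian) (m : ℕ) :
    ‖Y‖ ^ (2 * 2 ^ m) ≤ ((Y ^ (2 * 2 ^ m)).trace).re := by
  rw [re_trace_pow_two_mul hY, mul_comm 2, pow_mul,
    ← IsSelfAdjoint.norm_pow_two_pow (x := Y) hY m]
  exact pow_le_pow_left₀ (norm_nonneg _) (opNorm_le_hsNorm _) 2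

/-- The Hilbert–Schmidt norm of the mixed words in the expansion of a power of `Y + H` is bounded by
the corresponding commutative expression. -/
lemma hsNorm_mixed_le (Y H : Matrix n n ℂ) (k : ℕ) :
    hsNorm ((Y + H) ^ (k + 1) - Y ^ (k + 1) - H ^ (k + 1)) ≤
      (‖Y‖ + hsNorm H) ^ (k + 1) - ‖Y‖ ^ (k + 1) - hsNorm H ^ (k + 1) := by
  induction k with
  | zero => simp [hsNorm]
  | succ k ih =>
    set T := (Y + H) ^ (k + 1) - Y ^ (k + 1) - H ^ (k + 1) with hT
    have hrec : (Y + H) ^ (k + 1 + 1) - Y ^ (k + 1 + 1) - H ^ (k + 1 + 1) =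
        ((T * Y + H ^ (k + 1) * Y) + T * H) + Y ^ (k + 1) * H := by
      rw [hT]; simp only [pow_succ _ (k + 1)]; noncomm_ring
    rw [hrec]
    have hh := hsNorm_nonneg H
    have hy := norm_nonneg Y
    have h1 := (hsNorm_mul_le_mul_opNorm T Y).trans (mul_le_mul_of_nonneg_right ih hy)
    have h2 := (hsNorm_mul_le_mul_opNorm (H ^ (k + 1)) Y).trans
      (mul_le_mul_of_nonneg_right (hsNorm_pow_le H k) hy)
    have h3 := (hsNorm_mul_le T H).trans (mul_le_mul_of_nonneg_right ih hh)
    have h4 : hsNorm (Y ^ (k + 1) * H) ≤ ‖Y‖ ^ (k + 1) * hsNorm H :=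
      (hsNorm_mul_le_opNorm_mul _ _).trans
        (mul_le_mul_of_nonneg_right (norm_pow_le' Y k.succ_pos) hh)
    have h5 := hsNorm_add_le ((T * Y + H ^ (k + 1) * Y) + T * H) (Y ^ (k + 1) * H)
    have h6 := hsNorm_add_le (T * Y + H ^ (k + 1) * Y) (T * H)
    have h7 := hsNorm_add_le (T * Y) (H ^ (k + 1) * Y)
    refine h5.trans ?_
    have : (‖Y‖ + hsNorm H) ^ (k + 1 + 1) - ‖Y‖ ^ (k + 1 + 1) - hsNorm H ^ (k + 1 + 1) =
      ((‖Y‖ + hsNorm H) ^ (k + 1) - ‖Y‖ ^ (k + 1) - hsNorm H ^ (k + 1)) * ‖Y‖ +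
      hsNorm H ^ (k + 1) * ‖Y‖ +
      ((‖Y‖ + hsNorm H) ^ (k + 1) - ‖Y‖ ^ (k + 1) - hsNorm H ^ (k + 1)) * hsNorm H +
      ‖Y‖ ^ (k + 1) * hsNorm H := by ring
    linarith

lemma add_pow_sub_pow_le {y h : ℝ} (hy : 0 ≤ y) (hh : 0 ≤ h) (k : ℕ) :
    (y + h) ^ (k + 1) - h ^ (k + 1) ≤ (k + 1) * (y * (y + h) ^ k) := by
  induction k with
  | zero => simp
  | succ k ih =>
    have h1 := mul_le_mul_of_nonneg_right ih hh
    have h2 : h * (y * (y + h) ^ k) ≤ (y + h) * (y * (y + h) ^ k) :=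
      mul_le_mul_of_nonneg_right (by linarith) (by positivity)
    have h3 := mul_le_mul_of_nonneg_left h2 (by positivity : (0 : ℝ) ≤ k + 1)
    have e : (y + h) ^ (k + 1 + 1) - h ^ (k + 1 + 1) =
        ((y + h) ^ (k + 1) - h ^ (k + 1)) * h + y * (y + h) ^ (k + 1) := by ring
    rw [e]
    push_cast
    have e2 : (k + 1 : ℝ) * ((y + h) * (y * (y + h) ^ k)) = (k + 1) * (y * (y + h) ^ (k + 1)) := by
      ring
    linarith

/-- The words of the expansion that contain both matrices, followed by a power of `Y`. The words
with a single factor `H` cost the factor `√n`; those with two factors `H` or more are trace class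
without it. -/
lemma norm_trace_mixed_mul_pow_le (Y H : Matrix n n ℂ) (k j : ℕ) :
    ‖(((Y + H) ^ (k + 1) - Y ^ (k + 1) - H ^ (k + 1)) * Y ^ j).trace‖ ≤
      (k + 1) ^ 2 * (√(Fintype.card n) * ‖Y‖ ^ (k + j) * hsNorm H +
        ‖Y‖ * hsNorm H * (‖Y‖ + hsNorm H) ^ (k + j - 1)) := by
  have hh := hsNorm_nonneg H
  have hy := norm_nonneg Y
  induction k generalizing j with
  | zero =>
    simp only [zero_add, pow_one, add_sub_cancel_left, sub_self, zero_mul, Matrix.trace_zero,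
      norm_zero]
    positivity
  | succ k ih =>
    set y := ‖Y‖
    set h := hsNorm H
    set s := √(Fintype.card n)
    have hs0 : 0 ≤ s := Real.sqrt_nonneg _
    set T := (Y + H) ^ (k + 1) - Y ^ (k + 1) - H ^ (k + 1) with hT
    have hrec : ((Y + H) ^ (k + 1 + 1) - Y ^ (k + 1 + 1) - H ^ (k + 1 + 1)) * Y ^ j =
        T * Y ^ (j + 1) + H ^ (k + 1) * Y ^ (j + 1) + T * (H * Y ^ j) +
          Y ^ (k + 1) * (H * Y ^ j) := by
      rw [hT, pow_succ' Y j]; simp only [pow_succ _ (k + 1)]; noncomm_ring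
    have e1 : k + 1 + j - 1 = k + j := by omega
    have e2 : k + (j + 1) = k + 1 + j := by omega
    set E := s * y ^ (k + 1 + j) * h + y * h * (y + h) ^ (k + j) with hE
    have hyh : y ≤ y + h := by linarith
    have hhy : h ≤ y + h := by linarith
    have b1 : ‖(T * Y ^ (j + 1)).trace‖ ≤ (k + 1) ^ 2 * E := by
      have := ih (j + 1)
      rwa [e2, e1] at this
    have b2 : ‖(H ^ (k + 1) * Y ^ (j + 1)).trace‖ ≤ E := by
      have hHY : hsNorm (H * Y ^ (j + 1)) ≤ h * y ^ (j + 1) := hsNorm_mul_pow_le _ _ _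
      cases k with
      | zero =>
        rw [zero_add, pow_one, ← one_mul H, mul_assoc]
        refine (norm_trace_mul_le _ _).trans ?_
        rw [hsNorm_one]
        calc s * hsNorm (H * Y ^ (j + 1)) ≤ s * (h * y ^ (j + 1)) := by gcongr
          _ = s * y ^ (0 + 1 + j) * h := by rw [zero_add, add_comm 1 j]; ring
          _ ≤ E := le_add_of_nonneg_right (by positivity)
      | succ k =>
        rw [pow_succ, mul_assoc]
        refine (norm_trace_mul_le _ _).trans ?_
        calc hsNorm (H ^ (k + 1)) * hsNorm (H * Y ^ (j + 1)) ≤ h ^ (k + 1) * (h * y ^ (j + 1)) := by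
              gcongr
              · exact hsNorm_nonneg _
              · exact hsNorm_pow_le H k
          _ = y * h * (h ^ (k + 1) * y ^ j) := by ring
          _ ≤ y * h * ((y + h) ^ (k + 1) * (y + h) ^ j) := by gcongr
          _ = y * h * (y + h) ^ (k + 1 + j) := by rw [← pow_add]
          _ ≤ E := le_add_of_nonneg_left (by positivity)
    have b3 : ‖(T * (H * Y ^ j)).trace‖ ≤ (k + 1) * E := by
      have hTb : hsNorm T ≤ (k + 1) * (y * (y + h) ^ k) := by
        refine (hsNorm_mixed_le Y H k).trans (le_trans ?_ (add_pow_sub_pow_le hy hh k))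
        have : 0 ≤ y ^ (k + 1) := by positivity
        linarith
      refine (norm_trace_mul_le _ _).trans ?_
      calc hsNorm T * hsNorm (H * Y ^ j) ≤ (k + 1) * (y * (y + h) ^ k) * (h * y ^ j) := by
            gcongr
            · exact hsNorm_nonneg _
            · exact hsNorm_mul_pow_le _ _ _
        _ = (k + 1) * (y * h * ((y + h) ^ k * y ^ j)) := by ring
        _ ≤ (k + 1) * (y * h * ((y + h) ^ k * (y + h) ^ j)) := by gcongr
        _ = (k + 1) * (y * h * (y + h) ^ (k + j)) := by rw [← pow_add]
        _ ≤ (k + 1) * E := by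
            gcongr
            exact le_add_of_nonneg_left (by positivity)
    have b4 : ‖(Y ^ (k + 1) * (H * Y ^ j)).trace‖ ≤ E := by
      refine (norm_trace_mul_le _ _).trans ?_
      calc hsNorm (Y ^ (k + 1)) * hsNorm (H * Y ^ j) ≤ (s * y ^ (k + 1)) * (h * y ^ j) := by
            gcongr
            · exact hsNorm_nonneg _
            · exact hsNorm_pow_le_card _ _
            · exact hsNorm_mul_pow_le _ _ _
        _ = s * y ^ (k + 1 + j) * h := by ring
        _ ≤ E := le_add_of_nonneg_right (by positivity)
    rw [hrec, Matrix.trace_add, Matrix.trace_add, Matrix.trace_add, e1]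
    refine (norm_add_le _ _).trans ((add_le_add (norm_add₃_le) le_rfl).trans ?_)
    have hE0 : 0 ≤ E := by positivity
    push_cast
    nlinarith

/-- The trace of a power is additive up to the mixed words, each of which contains a factor `Y`,
measured in operator norm, and a factor `H`, measured in Hilbert–Schmidt norm. -/
theorem norm_trace_add_pow_sub_le (Y H : Matrix n n ℂ) {p : ℕ} (hp : 2 ≤ p) :
    ‖((Y + H) ^ p).trace - (Y ^ p).trace - (H ^ p).trace‖ ≤
      p ^ 2 * (√(Fintype.card n) * ‖Y‖ ^ (p - 1) * hsNorm H +
        ‖Y‖ * hsNorm H * (‖Y‖ + hsNorm H) ^ (p - 2)) := by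
  obtain ⟨k, rfl⟩ : ∃ k, p = k + 1 := ⟨p - 1, by omega⟩
  have := norm_trace_mixed_mul_pow_le Y H k 0
  simp only [pow_zero, mul_one, add_zero, Matrix.trace_sub] at this
  exact_mod_cast this

end Trace

/-! ### Gaussian integration by parts for polynomials -/

lemma integrable_pow_gaussianReal (n : ℕ) : Integrable (fun x : ℝ => x ^ n) (gaussianReal 0 1) := by
  cases n with
  | zero => simp
  | succ n =>
    have := (memLp_id_gaussianReal (μ := 0) (v := 1) ((n + 1 : ℕ) : ℝ≥0)).integrable_norm_pow'
    refine Integrable.mono' (by simpa using this) (by fun_prop) (ae_of_all _ fun x => ?_)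
    simp

lemma integral_pow_succ_gaussianReal (n : ℕ) :
    ∫ x, x ^ (n + 1) ∂gaussianReal 0 1 = n * ∫ x, x ^ (n - 1) ∂gaussianReal 0 1 := by
  have hint : ∀ m : ℕ, Integrable (fun x : ℝ => x ^ m * gaussianPDFReal 0 1 x) := by
    intro m
    have := integrable_pow_gaussianReal m
    rw [gaussianReal_of_var_ne_zero _ one_ne_zero, integrable_withDensity_iff_integrable_smul'
      (measurable_gaussianPDF 0 1) (ae_of_all _ fun x => gaussianPDF_lt_top)] at this
    simpa [toReal_gaussianPDF, mul_comm] using this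
  have hpdf : ∀ x, HasDerivAt (fun x => -gaussianPDFReal 0 1 x) (x * gaussianPDFReal 0 1 x) x := by
    intro x
    have h1 : HasDerivAt (fun x : ℝ => -(√(2 * Real.pi * (1 : ℝ≥0)))⁻¹ *
        Real.exp (-(x - 0) ^ 2 / (2 * (1 : ℝ≥0)))) _ x :=
      (((((hasDerivAt_id x).sub_const 0).pow 2).neg.div_const
        (2 * ((1 : ℝ≥0) : ℝ))).exp).const_mul _
    convert h1 using 1
    · ext y; simp [gaussianPDFReal]
    · simp [gaussianPDFReal]; ring
  have key := integral_mul_deriv_eq_deriv_mul_of_integrable (u := fun x : ℝ => x ^ n)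
    (v := fun x => -gaussianPDFReal 0 1 x) (u' := fun x => n * x ^ (n - 1))
    (v' := fun x => x * gaussianPDFReal 0 1 x) (fun x _ => hasDerivAt_pow n x) (fun x _ => hpdf x)
    (by simpa [Pi.mul_def, pow_succ, mul_assoc] using hint (n + 1))
    (by simpa [Pi.mul_def, mul_assoc] using ((hint (n - 1)).const_mul (n : ℝ)).neg)
    (by simpa [Pi.mul_def] using (hint n).neg)
  rw [integral_gaussianReal_eq_integral_smul one_ne_zero,
    integral_gaussianReal_eq_integral_smul one_ne_zero, ← integral_const_mul]
  simp only [mul_neg, integral_neg, neg_neg] at key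
  refine (integral_congr_ae (ae_of_all _ fun x => ?_)).trans
    (key.trans (integral_congr_ae (ae_of_all _ fun x => ?_)))
  · simp only [smul_eq_mul]; ring
  · simp only [smul_eq_mul]; ring

section Stein

variable {K : Type*} [Fintype K]

lemma eval_monomial_ofReal (s : K →₀ ℕ) (c : ℂ) (g : K → ℝ) :
    MvPolynomial.eval (fun k => (g k : ℂ)) (MvPolynomial.monomial s c) =
      c * ∏ k, ((g k : ℂ) ^ s k) := by
  rw [MvPolynomial.eval_monomial, Finsupp.prod_fintype _ _ fun _ => pow_zero _]

lemma integrable_eval_gaussian (P : MvPolynomial K ℂ) :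
    Integrable (fun g : K → ℝ => MvPolynomial.eval (fun k => (g k : ℂ)) P)
      (Measure.pi fun _ : K => gaussianReal 0 1) := by
  induction P using MvPolynomial.induction_on' with
  | monomial s c =>
    simp_rw [eval_monomial_ofReal]
    refine Integrable.const_mul ?_ _
    refine Integrable.fintype_prod (f := fun k (x : ℝ) => (x : ℂ) ^ s k) fun k => ?_
    have := (integrable_pow_gaussianReal (s k)).ofReal (𝕜 := ℂ)
    simpa using this
  | add P Q hP hQ =>
    simp only [map_add]
    exact hP.add hQ

/-- The expectation of a polynomial in independent standard Gaussian variables. -/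
noncomputable def gaussianExpectation (K : Type*) [Fintype K] : MvPolynomial K ℂ →ₗ[ℂ] ℂ where
  toFun P := ∫ g, MvPolynomial.eval (fun k => (g k : ℂ)) P
    ∂(Measure.pi fun _ : K => gaussianReal 0 1)
  map_add' P Q := by
    simp only [map_add]
    exact integral_add (integrable_eval_gaussian P) (integrable_eval_gaussian Q)
  map_smul' c P := by
    simp only [MvPolynomial.smul_eval, integral_const_mul, RingHom.id_apply, smul_eq_mul]

lemma gaussianExpectation_apply (P : MvPolynomial K ℂ) :
    gaussianExpectation K P = ∫ g, MvPolynomial.eval (fun k => (g k : ℂ)) P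
      ∂(Measure.pi fun _ : K => gaussianReal 0 1) := rfl

lemma gaussianExpectation_one : gaussianExpectation K 1 = 1 := by
  simp [gaussianExpectation_apply]

lemma gaussianExpectation_monomial (s : K →₀ ℕ) (c : ℂ) :
    gaussianExpectation K (MvPolynomial.monomial s c) =
      c * ∏ k, ((∫ x, x ^ s k ∂gaussianReal 0 1 : ℝ) : ℂ) := by
  simp_rw [gaussianExpectation_apply, eval_monomial_ofReal]
  rw [integral_const_mul, integral_fintype_prod_eq_prod (f := fun k (x : ℝ) => (x : ℂ) ^ s k)]
  congr 2
  ext k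
  rw [← integral_complex_ofReal]
  push_cast
  rfl

/-- Stein's identity. -/
lemma gaussianExpectation_X_mul [DecidableEq K] (k : K) (P : MvPolynomial K ℂ) :
    gaussianExpectation K (MvPolynomial.X k * P) =
      gaussianExpectation K (MvPolynomial.pderiv k P) := by
  induction P using MvPolynomial.induction_on' with
  | monomial s c =>
    rw [MvPolynomial.X, MvPolynomial.monomial_mul, one_mul, MvPolynomial.pderiv_monomial,
      gaussianExpectation_monomial, gaussianExpectation_monomial,
      ← Finset.mul_prod_erase _ _ (Finset.mem_univ k),
      ← Finset.mul_prod_erase _ _ (Finset.mem_univ k)]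
    have h1 : ∀ j ∈ Finset.univ.erase k, ((∫ x, x ^ ((Finsupp.single k 1 + s : K →₀ ℕ) j)
        ∂gaussianReal 0 1 : ℝ) : ℂ) = ((∫ x, x ^ ((s - Finsupp.single k 1 : K →₀ ℕ) j)
        ∂gaussianReal 0 1 : ℝ) : ℂ) := by
      intro j hj
      have : k ≠ j := (Finset.ne_of_mem_erase hj).symm
      simp [this]
    rw [Finset.prod_congr rfl h1]
    have h2 : (Finsupp.single k 1 + s : K →₀ ℕ) k = s k + 1 := by simp [add_comm]
    have h3 : (s - Finsupp.single k 1 : K →₀ ℕ) k = s k - 1 := by simp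
    rw [h2, h3, integral_pow_succ_gaussianReal]
    push_cast
    ring
  | add P Q hP hQ => rw [mul_add, map_add, map_add, map_add, hP, hQ]

end Stein

/-! ### Loop equations -/

section Loop

set_option linter.unusedSectionVars false

open scoped Matrix

variable {n R : Type*} [Fintype n] [DecidableEq n] [CommRing R] [Algebra ℂ R]

/-- An algebraic Gaussian matrix ensemble: `E` plays the role of the expectation, `D i j` is the
derivation which the entry `M i j` becomes under Gaussian integration by parts, and the covariance
`E[M i j * M u v]` is `ρ` if `(u, v) = (j, i)`, plus `ρ τ` if `(u, v) = (i, j)`. The two cases of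
the last field are the complex Hermitian one (`τ = 0`) and the real symmetric one (`τ = 1`). -/
structure IsGaussianEnsemble (E : R →ₗ[ℂ] ℂ) (M : Matrix n n R) (D : n → n → Derivation ℂ R R)
    (ρ τ : ℂ) : Prop where
  map_one : E 1 = 1
  parts : ∀ i j F, E (M i j * F) = E (D i j F)
  covariance : ∀ i j, M.map (D i j) =
    ρ • (τ • Matrix.single i j (1 : R) + Matrix.single j i (1 : R))
  symm : τ = 0 ∨ Mᵀ = M

lemma map_derivation_mul (D : Derivation ℂ R R) (A B : Matrix n n R) :
    (A * B).map D = A.map D * B + A * B.map D := by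
  ext i j
  simp only [Matrix.map_apply, Matrix.mul_apply, Matrix.add_apply, map_sum, Derivation.leibniz,
    smul_eq_mul, Finset.sum_add_distrib]
  rw [add_comm]
  congr 1
  exact Finset.sum_congr rfl fun k _ => mul_comm _ _

lemma map_derivation_pow (D : Derivation ℂ R R) (A : Matrix n n R) (k : ℕ) :
    (A ^ k).map D = ∑ l ∈ Finset.range k, A ^ l * A.map D * A ^ (k - 1 - l) := by
  induction k with
  | zero =>
    ext i j
    simp [Matrix.one_apply, apply_ite D]
  | succ k ih =>
    rw [pow_succ, map_derivation_mul, ih, Finset.sum_range_succ, Finset.sum_mul]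
    congr 1
    · refine Finset.sum_congr rfl fun l hl => ?_
      have hl := Finset.mem_range.1 hl
      rw [mul_assoc, ← pow_succ]
      congr 2
      omega
    · simp

/-- The normalized trace of a power of `M`. -/
noncomputable def momentElement (M : Matrix n n R) (ρ : ℂ) (k : ℕ) : R := ρ • (M ^ k).trace

variable {E : R →ₗ[ℂ] ℂ} {M : Matrix n n R} {D : n → n → Derivation ℂ R R} {ρ τ : ℂ}

namespace IsGaussianEnsemble

lemma smul_sum_mul (h : IsGaussianEnsemble E M D ρ τ) (l r : ℕ) :
    τ • (∑ i, ∑ j, (M ^ l) j i * (M ^ r) j i) = τ • (M ^ (l + r)).trace := by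
  rcases h.symm with h0 | hM
  · simp [h0]
  · congr 1
    rw [pow_add, Finset.sum_comm, Matrix.trace]
    refine Finset.sum_congr rfl fun j _ => ?_
    rw [Matrix.diag_apply, Matrix.mul_apply]
    refine Finset.sum_congr rfl fun i _ => ?_
    have : (M ^ r)ᵀ = M ^ r := by rw [Matrix.transpose_pow, hM]
    rw [← Matrix.transpose_apply (M ^ r) i j, this]

lemma pow_entry_derivation (h : IsGaussianEnsemble E M D ρ τ) (k : ℕ) (i j u v : n) :
    D i j ((M ^ k) u v) = ρ • ∑ l ∈ Finset.range k,
      (τ • ((M ^ l) u i * (M ^ (k - 1 - l)) j v) + (M ^ l) u j * (M ^ (k - 1 - l)) i v) := by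
  rw [← Matrix.map_apply (f := D i j), map_derivation_pow, h.covariance, Matrix.sum_apply,
    Finset.smul_sum]
  refine Finset.sum_congr rfl fun l _ => ?_
  have hs : ∀ a b, (M ^ l * Matrix.single a b (1 : R) * M ^ (k - 1 - l)) u v =
      (M ^ l) u a * (M ^ (k - 1 - l)) b v := by
    intro a b
    rw [Matrix.mul_apply, Finset.sum_eq_single b]
    · simp
    · intro c _ hc
      rw [Matrix.mul_single_apply_of_ne _ _ _ _ _ hc, zero_mul]
    · simp
  rw [Matrix.mul_smul, Matrix.smul_mul, Matrix.mul_add, Matrix.mul_smul, Matrix.add_mul,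
    Matrix.smul_mul, Matrix.smul_apply, Matrix.add_apply, Matrix.smul_apply, hs, hs]

lemma sum_pow_entry_derivation (h : IsGaussianEnsemble E M D ρ τ) (k : ℕ) :
    ∑ i, ∑ j, D i j ((M ^ k) j i) = ρ • ∑ l ∈ Finset.range k,
      (τ • (M ^ (k - 1)).trace + (M ^ l).trace * (M ^ (k - 1 - l)).trace) := by
  simp only [h.pow_entry_derivation, ← Finset.smul_sum]
  congr 1
  rw [Finset.sum_comm' (t' := Finset.univ) (s' := fun _ => Finset.univ) (by simp)]
  simp_rw [Finset.sum_comm (s := (Finset.univ : Finset n)) (t := Finset.range k)]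
  refine Finset.sum_congr rfl fun l hl => ?_
  have hl := Finset.mem_range.1 hl
  have e : l + (k - 1 - l) = k - 1 := by omega
  simp only [Finset.sum_add_distrib, ← Finset.smul_sum]
  congr 1
  · rw [Finset.sum_comm, h.smul_sum_mul, e]
  · simp only [Matrix.trace, Matrix.diag_apply, Finset.sum_mul_sum]

/-- The derivation produced by integrating by parts against `tr (M ^ (k + 1))`. -/
noncomputable def loopDerivation (M : Matrix n n R) (D : n → n → Derivation ℂ R R) (k : ℕ) :
    Derivation ℂ R R := ∑ i, ∑ j, (M ^ k) j i • D i j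

lemma loopDerivation_apply (k : ℕ) (F : R) :
    loopDerivation M D k F = ∑ i, ∑ j, (M ^ k) j i * D i j F := by
  have hsum : ∀ f : n → Derivation ℂ R R, (∑ i, f i) F = ∑ i, f i F := fun f => by
    rw [← Derivation.coeFnAddMonoidHom_apply, map_sum, Finset.sum_apply]
    rfl
  simp only [loopDerivation, hsum, Derivation.smul_apply, smul_eq_mul]

lemma loopDerivation_momentElement (h : IsGaussianEnsemble E M D ρ τ) (k m : ℕ) :
    loopDerivation M D k (momentElement M ρ m) =
      (ρ * (1 + τ) * m) • momentElement M ρ (k + m - 1) := by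
  have h1 : ∀ i j, D i j (momentElement M ρ m) =
      (ρ * ρ * m) • (τ • (M ^ (m - 1)) j i + (M ^ (m - 1)) i j) := by
    intro i j
    rw [momentElement, Derivation.map_smul, Matrix.trace, map_sum]
    simp only [Matrix.diag_apply, h.pow_entry_derivation, ← Finset.smul_sum]
    rw [Finset.sum_comm, smul_smul]
    have : ∀ l ∈ Finset.range m, ∑ u, (τ • ((M ^ l) u i * (M ^ (m - 1 - l)) j u) +
        (M ^ l) u j * (M ^ (m - 1 - l)) i u) = τ • (M ^ (m - 1)) j i + (M ^ (m - 1)) i j := by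
      intro l hl
      have hl := Finset.mem_range.1 hl
      have e : m - 1 = (m - 1 - l) + l := by omega
      simp only [Finset.sum_add_distrib, ← Finset.smul_sum]
      nth_rw 3 [e]
      nth_rw 4 [e]
      rw [pow_add, Matrix.mul_apply, Matrix.mul_apply]
      simp only [mul_comm]
    rw [Finset.sum_congr rfl this, Finset.sum_const, Finset.card_range, mul_smul (ρ * ρ),
      Nat.cast_smul_eq_nsmul]
  rw [loopDerivation_apply]
  simp only [h1]
  rcases Nat.eq_zero_or_pos m with rfl | hm
  · simp
  have e : k + (m - 1) = k + m - 1 := by omega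
  have h2 := h.smul_sum_mul k (m - 1)
  have h3 : ∑ i, ∑ j, (M ^ k) j i * (M ^ (m - 1)) i j = (M ^ (k + (m - 1))).trace := by
    rw [Finset.sum_comm, pow_add]
    rfl
  simp only [mul_smul_comm, mul_add (_ : R), ← Finset.smul_sum, Finset.sum_add_distrib]
  rw [h2, h3, e, momentElement]
  module

/-- The loop (Schwinger–Dyson) equation. -/
lemma loop_equation (h : IsGaussianEnsemble E M D ρ τ) (k : ℕ) (F : R) :
    E (momentElement M ρ (k + 1) * F) =
      ∑ l ∈ Finset.range k, E (momentElement M ρ l * (momentElement M ρ (k - 1 - l) * F)) +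
      ρ * τ * k * E (momentElement M ρ (k - 1) * F) + ρ * E (loopDerivation M D k F) := by
  have h1 : E (momentElement M ρ (k + 1) * F) =
      ρ * E (∑ i, ∑ j, (D i j ((M ^ k) j i) * F + (M ^ k) j i * D i j F)) := by
    rw [momentElement, smul_mul_assoc, map_smul, smul_eq_mul, pow_succ', Matrix.trace,
      Finset.sum_mul]
    simp only [Matrix.diag_apply, Matrix.mul_apply, Finset.sum_mul, map_sum, mul_assoc, h.parts,
      Derivation.leibniz, smul_eq_mul]
    congr 1
    refine Finset.sum_congr rfl fun i _ => Finset.sum_congr rfl fun j _ => ?_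
    rw [add_comm, mul_comm F]
  rw [h1]
  simp only [Finset.sum_add_distrib, ← Finset.sum_mul]
  rw [h.sum_pow_entry_derivation, map_add, ← loopDerivation_apply, mul_add]
  congr 1
  rw [Finset.sum_add_distrib, Finset.sum_const, Finset.card_range, smul_add, add_mul, map_add,
    mul_add, add_comm]
  congr 1
  · rw [Finset.smul_sum, Finset.sum_mul, map_sum, Finset.mul_sum]
    refine Finset.sum_congr rfl fun l _ => ?_
    simp only [momentElement, smul_mul_assoc, mul_smul_comm, map_smul, smul_eq_mul, mul_assoc]
  · rw [← Nat.cast_smul_eq_nsmul ℂ]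
    simp only [momentElement, smul_mul_assoc, map_smul, smul_eq_mul]
    ring

end IsGaussianEnsemble

end Loop

/-! ### Moments of the semicircle law -/

/-- The `k`-th moment of the semicircle law. -/
def semicircleMoment (k : ℕ) : ℕ := if Even k then catalan (k / 2) else 0

lemma sum_range_two_mul_add_one {A : Type*} [AddCommMonoid A] (f : ℕ → A) (m : ℕ) :
    ∑ l ∈ Finset.range (2 * m + 1), f l =
      ∑ i ∈ Finset.range (m + 1), f (2 * i) + ∑ i ∈ Finset.range m, f (2 * i + 1) := by
  induction m with
  | zero => simp
  | succ m ih =>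
    rw [show 2 * (m + 1) + 1 = 2 * m + 1 + 1 + 1 by ring, Finset.sum_range_succ,
      Finset.sum_range_succ, ih, Finset.sum_range_succ _ (m + 1),
      Finset.sum_range_succ (fun i => f (2 * i + 1)) m, show 2 * m + 1 + 1 = 2 * (m + 1) by ring,
      add_assoc, add_assoc, add_assoc, add_comm (f (2 * (m + 1))), add_assoc]

lemma semicircleMoment_succ (k : ℕ) : semicircleMoment (k + 1) =
    ∑ l ∈ Finset.range k, semicircleMoment l * semicircleMoment (k - 1 - l) := by
  rcases Nat.even_or_odd' k with ⟨m, rfl | rfl⟩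
  · rw [semicircleMoment, if_neg (by simp)]
    refine (Finset.sum_eq_zero fun l hl => ?_).symm
    have hl := Finset.mem_range.1 hl
    rcases Nat.even_or_odd l with h | h
    · have : ¬ Even (2 * m - 1 - l) := by
        rw [Nat.not_even_iff_odd]
        obtain ⟨r, rfl⟩ := h
        exact ⟨m - 1 - r, by omega⟩
      rw [semicircleMoment.eq_1 (2 * m - 1 - l), if_neg this, mul_zero]
    · rw [semicircleMoment, if_neg (Nat.not_even_iff_odd.2 h), zero_mul]
  · have he : Even (2 * m + 1 + 1) := ⟨m + 1, by ring⟩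
    rw [semicircleMoment, if_pos he, show (2 * m + 1 + 1) / 2 = m + 1 by omega, catalan_succ,
      sum_range_two_mul_add_one]
    have hodd : ∑ i ∈ Finset.range m, semicircleMoment (2 * i + 1) *
        semicircleMoment (2 * m + 1 - 1 - (2 * i + 1)) = 0 :=
      Finset.sum_eq_zero fun i _ => by rw [semicircleMoment, if_neg (by simp), zero_mul]
    rw [hodd, add_zero, ← Fin.sum_univ_eq_sum_range (fun i => semicircleMoment (2 * i) *
      semicircleMoment (2 * m + 1 - 1 - 2 * i)) (m + 1)]
    refine Finset.sum_congr rfl fun i _ => ?_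
    have hi := i.2
    rw [semicircleMoment, if_pos (even_two_mul _), semicircleMoment,
      if_pos ⟨m - i, by omega⟩, show 2 * (i : ℕ) / 2 = i by omega,
      show (2 * m + 1 - 1 - 2 * (i : ℕ)) / 2 = m - i by omega]

/-! ### Convergence of mixed moments -/

/-- The terms produced when the loop derivation of index `k` acts on a product of moments indexed
by a list: each factor `a` in turn is replaced by `k + a - 1`, with weight `a`. -/
def contractions (k : ℕ) : List ℕ → List (ℕ × List ℕ)
  | [] => []
  | a :: L => (a, (k + a - 1) :: L) :: (contractions k L).map fun q => (q.1, a :: q.2)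

lemma sum_le_of_mem_contractions {k : ℕ} {L : List ℕ} {q : ℕ × List ℕ}
    (hq : q ∈ contractions k L) : q.2.sum ≤ k + L.sum := by
  induction L generalizing q with
  | nil => simp [contractions] at hq
  | cons a L ih =>
    simp only [contractions, List.mem_cons, List.mem_map] at hq
    rcases hq with rfl | ⟨q', hq', rfl⟩
    · simp only [List.sum_cons]; omega
    · have := ih hq'
      simp only [List.sum_cons]; omega

section

variable {n R : Type*} [Fintype n] [DecidableEq n] [CommRing R] [Algebra ℂ R]
  {E : R →ₗ[ℂ] ℂ} {M : Matrix n n R} {D : n → n → Derivation ℂ R R} {ρ τ : ℂ}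

lemma IsGaussianEnsemble.loopDerivation_prod (h : IsGaussianEnsemble E M D ρ τ) (k : ℕ)
    (L : List ℕ) : loopDerivation M D k (L.map (momentElement M ρ)).prod =
      (ρ * (1 + τ)) • ((contractions k L).map fun q =>
        (q.1 : ℂ) • (q.2.map (momentElement M ρ)).prod).sum := by
  induction L with
  | nil => simp [contractions]
  | cons a L ih =>
    have hsum : ∀ l : List (ℕ × List ℕ), momentElement M ρ a *
        (l.map fun q => (q.1 : ℂ) • (q.2.map (momentElement M ρ)).prod).sum =
        ((l.map fun q => (q.1, a :: q.2)).map fun q : ℕ × List ℕ =>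
          (q.1 : ℂ) • (q.2.map (momentElement M ρ)).prod).sum := by
      intro l
      induction l with
      | nil => simp
      | cons q l ihl =>
        simp only [List.map_cons, List.sum_cons, List.prod_cons, mul_add, ihl, mul_smul_comm]
    simp only [List.map_cons, List.prod_cons, Derivation.leibniz, smul_eq_mul, ih,
      h.loopDerivation_momentElement, contractions, List.sum_cons, smul_add]
    rw [mul_smul_comm, hsum, mul_smul_comm, smul_smul, mul_comm (L.map _).prod]
    abel

lemma momentElement_zero {N : ℕ} (hN : 0 < N) (M : Matrix (Fin N) (Fin N) R) :
    momentElement M (1 / N) 0 = 1 := by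
  have hN' : (N : ℂ) ≠ 0 := by exact_mod_cast hN.ne'
  rw [momentElement, pow_zero, Matrix.trace_one, Fintype.card_fin, Algebra.smul_def,
    ← map_natCast (algebraMap ℂ R) N, ← map_mul, one_div_mul_cancel hN', map_one]

end

/-- Asymptotic factorization: for Gaussian ensembles of size `N → ∞`, the expectation of a product
of normalized traces converges to the product of the moments of the semicircle law. -/
theorem tendsto_expectation_prod {R : ℕ → Type*} [∀ N, CommRing (R N)] [∀ N, Algebra ℂ (R N)]
    (E : ∀ N, R N →ₗ[ℂ] ℂ) (M : ∀ N, Matrix (Fin N) (Fin N) (R N))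
    (D : ∀ N, Fin N → Fin N → Derivation ℂ (R N) (R N)) (τ : ℂ)
    (h : ∀ N, 0 < N → IsGaussianEnsemble (E N) (M N) (D N) (1 / N) τ) (L : List ℕ) :
    Tendsto (fun N => E N (L.map (momentElement (M N) (1 / N))).prod) atTop
      (𝓝 (L.map fun k => (semicircleMoment k : ℂ)).prod) := by
  have hρ : Tendsto (fun N : ℕ => (1 / N : ℂ)) atTop (𝓝 0) :=
    tendsto_const_div_atTop_nhds_zero_nat 1
  -- a moment of index zero is one and can be dropped
  have hzero : ∀ L : List ℕ,
      Tendsto (fun N => E N (L.map (momentElement (M N) (1 / N))).prod) atTop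
        (𝓝 (L.map fun k => (semicircleMoment k : ℂ)).prod) →
      Tendsto (fun N => E N ((0 :: L).map (momentElement (M N) (1 / N))).prod) atTop
        (𝓝 ((0 :: L).map fun k => (semicircleMoment k : ℂ)).prod) := by
    intro L hL
    simp only [List.map_cons, List.prod_cons]
    have h0 : semicircleMoment 0 = 1 := by simp [semicircleMoment]
    rw [h0, Nat.cast_one, one_mul]
    refine hL.congr' ?_
    filter_upwards [eventually_gt_atTop 0] with N hN
    rw [momentElement_zero hN, one_mul]
  have key : ∀ s (L : List ℕ), L.sum ≤ s →
      Tendsto (fun N => E N (L.map (momentElement (M N) (1 / N))).prod) atTop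
        (𝓝 (L.map fun k => (semicircleMoment k : ℂ)).prod) := by
    intro s
    induction s with
    | zero =>
      intro L
      induction L with
      | nil =>
        intro _
        refine tendsto_const_nhds.congr' ?_
        filter_upwards [eventually_gt_atTop 0] with N hN
        simp [(h N hN).map_one]
      | cons a L ih =>
        intro hL
        simp only [List.sum_cons] at hL
        have ha : a = 0 := by omega
        subst ha
        exact hzero L (ih (by omega))
    | succ s ihs =>
      intro L
      induction L with
      | nil => intro _; exact ihs [] (by simp)
      | cons a L ih =>
        intro hL
        simp only [List.sum_cons] at hL
        rcases a with _ | k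
        · exact hzero L (ih (by omega))
        · have t1 : ∀ l ∈ Finset.range k, Tendsto (fun N => E N
              (((l :: (k - 1 - l) :: L)).map (momentElement (M N) (1 / N))).prod) atTop
              (𝓝 ((l :: (k - 1 - l) :: L).map fun k => (semicircleMoment k : ℂ)).prod) :=
            fun l hl => ihs _ (by
              have := Finset.mem_range.1 hl
              simp only [List.sum_cons]; omega)
          have t2 := ihs ((k - 1) :: L) (by simp only [List.sum_cons]; omega)
          have t3 : ∀ Q : List (ℕ × List ℕ), (∀ q ∈ Q, q.2.sum ≤ s) → ∃ x : ℂ,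
              Tendsto (fun N => E N (Q.map fun q =>
                (q.1 : ℂ) • (q.2.map (momentElement (M N) (1 / N))).prod).sum) atTop (𝓝 x) := by
            intro Q hQ
            induction Q with
            | nil => exact ⟨0, by simp⟩
            | cons q Q ihQ =>
              obtain ⟨x, hx⟩ := ihQ fun q' hq' => hQ q' (List.mem_cons_of_mem _ hq')
              refine ⟨_, (((ihs q.2 (hQ q List.mem_cons_self)).const_mul (q.1 : ℂ)).add hx).congr
                fun N => ?_⟩
              simp
          obtain ⟨x, hx⟩ := t3 (contractions k L) fun q hq =>
            (sum_le_of_mem_contractions hq).trans (by omega)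
          have lim := ((tendsto_finsetSum _ t1).add
            (((hρ.mul_const τ).mul_const (k : ℂ)).mul t2)).add
            (hρ.mul ((hρ.mul_const (1 + τ)).mul hx))
          simp only [zero_mul, add_zero] at lim
          have hval : (((k + 1) :: L).map fun k => (semicircleMoment k : ℂ)).prod =
              ∑ l ∈ Finset.range k, ((l :: (k - 1 - l) :: L).map
                fun k => (semicircleMoment k : ℂ)).prod := by
            simp only [List.map_cons, List.prod_cons, ← mul_assoc, ← Finset.sum_mul]
            rw [semicircleMoment_succ]
            push_cast
            rfl
          rw [hval]
          refine lim.congr' ?_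
          filter_upwards [eventually_gt_atTop 0] with N hN
          simp only [List.map_cons, List.prod_cons]
          rw [(h N hN).loop_equation, (h N hN).loopDerivation_prod, map_smul, smul_eq_mul]
  exact key L.sum L le_rfl

/-! ### The Gaussian matrix model -/

/-- A coefficient that takes one value above the diagonal, one below, and one on it. -/
def entryCoeff (a b w : ℂ) {N : ℕ} (i j : Fin N) : ℂ := if i < j then a else if j < i then b else w

/-- The Hermitian matrix with entries `u * x i j + v * x j i` above the diagonal and
`2 * Re w * x i i` on it. The values needed are `(u, v) = (1, 0)` for the real symmetric
ensemble and `(u, v) = (1, i) / √2` for the complex Hermitian one; `x` consists either of real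
numbers or of polynomial variables. -/
def gaussianMatrix {R : Type*} [CommRing R] [Algebra ℂ R] (u v w : ℂ) {N : ℕ}
    (x : Fin N × Fin N → R) : Matrix (Fin N) (Fin N) R :=
  Matrix.of fun i j => entryCoeff u (conj v) w i j • x (i, j) +
    entryCoeff v (conj u) (conj w) i j • x (j, i)

/-- The conditions on the coefficients under which `gaussianMatrix u v w` has the covariance
of a Gaussian ensemble of parameter `τ`: `0` in the complex Hermitian case and `1` in the real
symmetric one. They force the variance of the diagonal entries to be `1 + τ`. -/
structure IsEnsembleCoeff (u v w τ : ℂ) : Prop where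
  norm_off : u * conj u + v * conj v = 1
  norm_diag : 2 * (w * conj w) = 1
  sq_off : u ^ 2 + v ^ 2 = τ
  sq_diag : w ^ 2 + conj w ^ 2 = τ
  conj_tau : conj τ = τ
  symm : τ = 0 ∨ (conj u = u ∧ conj v = v ∧ conj w = w)

lemma conj_entryCoeff (a b w : ℂ) {N : ℕ} (i j : Fin N) :
    conj (entryCoeff a b w j i) = entryCoeff (conj b) (conj a) (conj w) i j := by
  unfold entryCoeff
  rcases lt_trichotomy i j with h | h | h
  · simp [h, h.not_gt]
  · simp [h]
  · simp [h, h.not_gt]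

lemma isHermitian_gaussianMatrix (u v w : ℂ) {N : ℕ} (g : Fin N × Fin N → ℝ) :
    (gaussianMatrix u v w fun k => (g k : ℂ)).IsHermitian := by
  ext i j
  simp only [gaussianMatrix, Matrix.conjTranspose_apply, Matrix.of_apply, smul_eq_mul,
    ← starRingEnd_apply, map_add, map_mul, conj_entryCoeff, Complex.conj_ofReal, Complex.conj_conj]
  rw [add_comm]

/-- The coefficients satisfy the orthogonality relations behind the covariance structure. -/
lemma IsEnsembleCoeff.orthogonality {u v w τ : ℂ} (h : IsEnsembleCoeff u v w τ) {N : ℕ}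
    (i j : Fin N) :
    entryCoeff u (conj v) w i j ^ 2 + entryCoeff v (conj u) (conj w) i j ^ 2 = τ ∧
    entryCoeff u (conj v) w i j * entryCoeff v (conj u) (conj w) j i +
      entryCoeff v (conj u) (conj w) i j * entryCoeff u (conj v) w j i = 1 := by
  unfold entryCoeff
  rcases lt_trichotomy i j with hij | hij | hij
  · simp only [hij, hij.not_gt, if_true, if_false]
    exact ⟨h.sq_off, h.norm_off⟩
  · simp only [hij, lt_irrefl, if_false]
    refine ⟨h.sq_diag, ?_⟩
    rw [← h.norm_diag]; ring
  · simp only [hij, hij.not_gt, if_true, if_false]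
    constructor
    · rw [← map_pow, ← map_pow, ← map_add, add_comm, h.sq_off, h.conj_tau]
    · rw [← h.norm_off]; ring

/-- The normalized matrix, with polynomial entries. -/
noncomputable def polynomialMatrix (u v w : ℂ) (N : ℕ) :
    Matrix (Fin N) (Fin N) (MvPolynomial (Fin N × Fin N) ℂ) :=
  (1 / (√N : ℂ)) • gaussianMatrix u v w MvPolynomial.X

/-- The derivation dual to the entry `(i, j)` of `polynomialMatrix`. -/
noncomputable def entryDerivation (u v w : ℂ) {N : ℕ} (i j : Fin N) :
    Derivation ℂ (MvPolynomial (Fin N × Fin N) ℂ) (MvPolynomial (Fin N × Fin N) ℂ) :=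
  (1 / (√N : ℂ)) • (entryCoeff u (conj v) w i j • MvPolynomial.pderiv (i, j) +
    entryCoeff v (conj u) (conj w) i j • MvPolynomial.pderiv (j, i))

lemma isGaussianEnsemble_polynomialMatrix {u v w τ : ℂ} (h : IsEnsembleCoeff u v w τ) (N : ℕ) :
    IsGaussianEnsemble (gaussianExpectation (Fin N × Fin N)) (polynomialMatrix u v w N)
      (entryDerivation u v w) (1 / N) τ where
  map_one := gaussianExpectation_one
  parts i j F := by
    simp only [polynomialMatrix, entryDerivation, gaussianMatrix, Matrix.smul_apply,
      Matrix.of_apply, smul_mul_assoc, add_mul, map_smul, map_add, gaussianExpectation_X_mul,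
      Derivation.smul_apply, Derivation.add_apply]
  covariance i j := by
    have hN : (1 / (√N : ℂ)) * (1 / (√N : ℂ)) = 1 / N := by
      rw [div_mul_div_comm, one_mul, ← Complex.ofReal_mul, Real.mul_self_sqrt (by positivity)]
      simp
    obtain ⟨h1, h2⟩ := h.orthogonality i j
    ext1 a b
    simp only [polynomialMatrix, entryDerivation, gaussianMatrix, Matrix.map_apply,
      Matrix.smul_apply, Matrix.of_apply, Derivation.map_smul, map_add, Derivation.smul_apply,
      Derivation.add_apply, MvPolynomial.pderiv_X, Pi.single_apply, Prod.mk.injEq,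
      Matrix.add_apply, Matrix.single_apply]
    rw [smul_comm (entryCoeff u (conj v) w a b), smul_comm (entryCoeff v (conj u) (conj w) a b),
      ← smul_add, smul_smul, hN]
    congr 1
    by_cases c1 : a = i ∧ b = j
    · obtain ⟨rfl, rfl⟩ := c1
      by_cases c2 : a = b
      · subst c2
        simp only [and_self, if_true, ← h1]
        simp only [← add_smul, smul_smul]
        rw [← one_smul ℂ (1 : MvPolynomial (Fin N × Fin N) ℂ)]
        simp only [smul_smul, ← add_smul]
        congr 1
        linear_combination h2
      · have c2' : ¬ b = a := fun h => c2 h.symm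
        simp only [c2, c2', and_self, if_true, if_false, smul_zero, add_zero, zero_add,
          ← h1, smul_smul, ← add_smul]
        congr 1
        ring
    · by_cases c2 : a = j ∧ b = i
      · obtain ⟨rfl, rfl⟩ := c2
        have c3 : ¬ a = b := fun hab => c1 ⟨hab, hab.symm⟩
        have c3' : ¬ b = a := fun h => c3 h.symm
        simp only [c3, c3', and_self, if_true, if_false, smul_zero, add_zero, zero_add,
          smul_smul, ← add_smul]
        rw [show entryCoeff u (conj v) w a b * entryCoeff v (conj u) (conj w) b a +
          entryCoeff v (conj u) (conj w) a b * entryCoeff u (conj v) w b a = 1 by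
            rw [← h2]; ring, one_smul]
      · have e1 : ¬ (b = i ∧ a = j) := fun h => c2 ⟨h.2, h.1⟩
        have e2 : ¬ (b = j ∧ a = i) := fun h => c1 ⟨h.2, h.1⟩
        have e3 : ¬ (i = a ∧ j = b) := fun h => c1 ⟨h.1.symm, h.2.symm⟩
        have e4 : ¬ (j = a ∧ i = b) := fun h => c2 ⟨h.1.symm, h.2.symm⟩
        simp only [c1, c2, e1, e2, e3, e4, if_false, smul_zero, add_zero]
  symm := by
    rcases h.symm with h0 | ⟨hu, hv, hw⟩
    · exact Or.inl h0
    · right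
      ext1 i j
      simp only [polynomialMatrix, gaussianMatrix, Matrix.transpose_apply, Matrix.smul_apply,
        Matrix.of_apply, hu, hv, hw]
      congr 1
      unfold entryCoeff
      rcases lt_trichotomy i j with hij | hij | hij
      · simp only [hij, hij.not_gt, if_true, if_false]; rw [add_comm]
      · simp [hij]
      · simp only [hij, hij.not_gt, if_true, if_false]; rw [add_comm]

/-- The normalized trace of `(M / √N) ^ p`, where `M` is the `N × N` matrix model. The trace is
real, and read as such through its real part. -/
noncomputable def modelTrace (u v w : ℂ) (p N : ℕ) (g : Fin N × Fin N → ℝ) : ℝ :=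
  1 / N * ((((1 / (√N : ℂ)) • gaussianMatrix u v w fun k => (g k : ℂ)) ^ p).trace).re

lemma isHermitian_smul_gaussianMatrix (u v w : ℂ) {N : ℕ} (g : Fin N × Fin N → ℝ) :
    ((1 / (√N : ℂ)) • gaussianMatrix u v w fun k => (g k : ℂ)).IsHermitian := by
  rw [Matrix.IsHermitian, Matrix.conjTranspose_smul, isHermitian_gaussianMatrix]
  simp

lemma eval_momentElement (u v w : ℂ) (p N : ℕ) (g : Fin N × Fin N → ℝ) :
    MvPolynomial.eval (fun k => (g k : ℂ)) (momentElement (polynomialMatrix u v w N) (1 / N) p) =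
      modelTrace u v w p N g := by
  have hmat : (polynomialMatrix u v w N).map (MvPolynomial.eval fun k => (g k : ℂ)) =
      (1 / (√N : ℂ)) • gaussianMatrix u v w fun k => (g k : ℂ) := by
    ext i j
    simp [polynomialMatrix, gaussianMatrix, MvPolynomial.smul_eval, mul_add]
  have hpow : ((polynomialMatrix u v w N) ^ p).map (MvPolynomial.eval fun k => (g k : ℂ)) =
      ((1 / (√N : ℂ)) • gaussianMatrix u v w fun k => (g k : ℂ)) ^ p := by
    rw [← hmat]
    exact map_pow (MvPolynomial.eval fun k => (g k : ℂ)).mapMatrix _ _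
  have hreal : (((1 / (√N : ℂ)) • gaussianMatrix u v w fun k => (g k : ℂ)) ^ p).trace =
      (((((1 / (√N : ℂ)) • gaussianMatrix u v w fun k => (g k : ℂ)) ^ p).trace).re : ℂ) := by
    refine (Complex.conj_eq_iff_re.1 ?_).symm
    rw [starRingEnd_apply, ← Matrix.trace_conjTranspose,
      (isHermitian_smul_gaussianMatrix u v w g).pow p]
  rw [momentElement, MvPolynomial.smul_eval, AddMonoidHom.map_trace, hpow, hreal, modelTrace]
  push_cast
  rfl

/-- Wigner's theorem for the Gaussian ensembles, with convergence in probability. -/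
theorem tendsto_measure_modelTrace {u v w τ : ℂ} (h : IsEnsembleCoeff u v w τ) (p : ℕ) {ε : ℝ}
    (hε : 0 < ε) :
    Tendsto (fun N => (Measure.pi fun _ : Fin N × Fin N => gaussianReal 0 1).real
      {g | ε ≤ |modelTrace u v w p N g - semicircleMoment p|}) atTop (𝓝 0) := by
  set c : ℝ := ((semicircleMoment p : ℕ) : ℝ)
  have hint : ∀ N, Integrable (modelTrace u v w p N)
      (Measure.pi fun _ : Fin N × Fin N => gaussianReal 0 1) := fun N => by
    have := integrable_eval_gaussian (momentElement (polynomialMatrix u v w N) (1 / N) p)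
    simp only [eval_momentElement] at this
    simpa using this.re
  have hint2 : ∀ N, Integrable (fun g => modelTrace u v w p N g ^ 2)
      (Measure.pi fun _ : Fin N × Fin N => gaussianReal 0 1) := fun N => by
    have := integrable_eval_gaussian (momentElement (polynomialMatrix u v w N) (1 / N) p ^ 2)
    simp only [map_pow, eval_momentElement, ← Complex.ofReal_pow] at this
    simpa only [RCLike.re_to_complex, Complex.ofReal_re] using this.re
  have lim1 : Tendsto (fun N => ∫ g, modelTrace u v w p N g
      ∂(Measure.pi fun _ : Fin N × Fin N => gaussianReal 0 1)) atTop (𝓝 c) := by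
    have := tendsto_expectation_prod _ _ _ τ
      (fun N _ => isGaussianEnsemble_polynomialMatrix h N) [p]
    have := (Complex.continuous_re.tendsto _).comp this
    simp only [List.map_cons, List.map_nil, List.prod_cons, List.prod_nil, mul_one,
      Complex.natCast_re, Function.comp_def, gaussianExpectation_apply, eval_momentElement,
      integral_complex_ofReal, Complex.ofReal_re] at this
    exact this
  have lim2 : Tendsto (fun N => ∫ g, modelTrace u v w p N g ^ 2
      ∂(Measure.pi fun _ : Fin N × Fin N => gaussianReal 0 1)) atTop (𝓝 (c * c)) := by
    have := tendsto_expectation_prod _ _ _ τ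
      (fun N _ => isGaussianEnsemble_polynomialMatrix h N) [p, p]
    have := (Complex.continuous_re.tendsto _).comp this
    simp only [List.map_cons, List.map_nil, List.prod_cons, List.prod_nil, mul_one,
      Function.comp_def, gaussianExpectation_apply, map_mul, eval_momentElement,
      ← Complex.ofReal_mul, integral_complex_ofReal, Complex.ofReal_re] at this
    simpa only [pow_two, c, ← Nat.cast_mul, Complex.natCast_re] using this
  have lim : Tendsto (fun N => (∫ g, (modelTrace u v w p N g - c) ^ 2
      ∂(Measure.pi fun _ : Fin N × Fin N => gaussianReal 0 1)) / ε ^ 2) atTop (𝓝 0) := by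
    have h3 := ((lim2.sub (lim1.const_mul (2 * c))).add_const (c ^ 2)).div_const (ε ^ 2)
    rw [show (c * c - 2 * c * c + c ^ 2) / ε ^ 2 = 0 by ring] at h3
    refine h3.congr fun N => ?_
    congr 1
    have hfun : ∀ g, (modelTrace u v w p N g - c) ^ 2 = modelTrace u v w p N g ^ 2 -
        2 * c * modelTrace u v w p N g + c ^ 2 := fun g => by ring
    simp_rw [hfun]
    have hsub : Integrable (fun g => modelTrace u v w p N g ^ 2 - 2 * c * modelTrace u v w p N g)
        (Measure.pi fun _ : Fin N × Fin N => gaussianReal 0 1) :=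
      (hint2 N).sub ((hint N).const_mul _)
    rw [integral_add hsub (integrable_const _),
      integral_sub (hint2 N) ((hint N).const_mul _), integral_const_mul, integral_const]
    simp
  refine squeeze_zero (fun _ => measureReal_nonneg) (fun N => ?_) lim
  rw [le_div_iff₀ (by positivity), mul_comm]
  have hsq : Integrable (fun g => (modelTrace u v w p N g - c) ^ 2)
      (Measure.pi fun _ : Fin N × Fin N => gaussianReal 0 1) := by
    refine (((hint2 N).sub ((hint N).const_mul (2 * c))).add (integrable_const (c ^ 2))).congr
      (ae_of_all _ fun g => ?_)
    simp only [Pi.add_apply, Pi.sub_apply]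
    ring
  refine le_trans (le_of_eq ?_) (mul_meas_ge_le_integral_of_nonneg
    (ae_of_all _ fun g => sq_nonneg _) hsq (ε ^ 2))
  congr 2
  ext g
  simp only [Set.mem_ofPred_eq]
  rw [← sq_abs (modelTrace u v w p N g - c), sq_le_sq₀ hε.le (abs_nonneg _)]

/-! ### The law of the matrix model -/

/-- Disjoint groups of independent variables are independent. -/
lemma iIndepFun_group {Ω ι K : Type*} [MeasurableSpace Ω] {P : Measure Ω} {κ : K → Type*}
    {f : ι → Ω → ℝ} (hf : ∀ i, Measurable (f i)) (hind : iIndepFun f P)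
    {e : (Σ k, κ k) → ι} (he : Function.Injective e) :
    iIndepFun (fun k ω (c : κ k) => f (e ⟨k, c⟩) ω) P := by
  have := hind.isProbabilityMeasure
  have hprob : ∀ i, IsProbabilityMeasure (P.map (f i)) := fun i =>
    Measure.isProbabilityMeasure_map (hf i).aemeasurable
  have h1 := (iIndepFun_iff_map_fun_eq_infinitePi_map fun p => hf (e p)).1 (hind.precomp he)
  rw [iIndepFun_iff_map_fun_eq_infinitePi_map (by fun_prop)]
  have h2 : ∀ k, P.map (fun ω (c : κ k) => f (e ⟨k, c⟩) ω) =
      Measure.infinitePi fun c : κ k => P.map (f (e ⟨k, c⟩)) := fun k =>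
    (iIndepFun_iff_map_fun_eq_infinitePi_map fun c => hf (e ⟨k, c⟩)).1
      (hind.precomp (g := fun c => e ⟨k, c⟩) (he.comp sigma_mk_injective))
  simp_rw [h2]
  rw [← Measure.infinitePi_map_piCurry (fun k c => P.map (f (e ⟨k, c⟩))), ← h1,
    Measure.map_map (by fun_prop) (by fun_prop)]
  rfl

/-- The matrix with prescribed entries on and above the diagonal, completed by conjugation. It is
Hermitian if the prescribed diagonal is real. -/
def hermitianFill {N : ℕ} (y : {k : Fin N × Fin N // k.1 ≤ k.2} → ℂ) : Matrix (Fin N) (Fin N) ℂ :=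
  Matrix.of fun i j => if h : i ≤ j then y ⟨(i, j), h⟩ else conj (y ⟨(j, i), le_of_not_ge h⟩)

lemma measurable_trace_hermitianFill (p N : ℕ) :
    Measurable fun y : {k : Fin N × Fin N // k.1 ≤ k.2} → ℂ =>
      1 / (N : ℝ) * ((((1 / (√N : ℂ)) • hermitianFill y) ^ p).trace).re := by
  have hcont : Continuous fun y : {k : Fin N × Fin N // k.1 ≤ k.2} → ℂ => hermitianFill y := by
    refine continuous_matrix fun i j => ?_
    by_cases h : i ≤ j
    · simp only [hermitianFill, Matrix.of_apply, h, dif_pos]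
      exact continuous_apply _
    · simp only [hermitianFill, Matrix.of_apply, h, dif_neg, not_false_eq_true]
      exact Complex.continuous_conj.comp (continuous_apply _)
  have : Continuous fun y : {k : Fin N × Fin N // k.1 ≤ k.2} → ℂ =>
      1 / (N : ℝ) * ((((1 / (√N : ℂ)) • hermitianFill y) ^ p).trace).re :=
    continuous_const.mul (Complex.continuous_re.comp
      ((hcont.const_smul (1 / (√N : ℂ))).pow p).matrix_trace)
  exact this.measurable

/-- The entry `(i, j)` of the matrix model. -/
noncomputable def modelEntry (u v w : ℂ) {N : ℕ} (k : Fin N × Fin N) (g : Fin N × Fin N → ℝ) : ℂ :=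
  entryCoeff u (conj v) w k.1 k.2 * g k + entryCoeff v (conj u) (conj w) k.1 k.2 * g k.swap

lemma gaussianMatrix_eq_hermitianFill (u v w : ℂ) {N : ℕ} (g : Fin N × Fin N → ℝ) :
    (gaussianMatrix u v w fun k => (g k : ℂ)) = hermitianFill fun k => modelEntry u v w k.1 g := by
  ext i j
  by_cases h : i ≤ j
  · simp [hermitianFill, h, modelEntry, gaussianMatrix]
  · have h2 := congrFun (congrFun (isHermitian_gaussianMatrix u v w g) i) j
    rw [Matrix.conjTranspose_apply, ← starRingEnd_apply] at h2
    rw [← h2]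
    simp [hermitianFill, h, modelEntry, gaussianMatrix]

lemma measurable_modelEntry (u v w : ℂ) {N : ℕ} (k : Fin N × Fin N) :
    Measurable (modelEntry u v w k) := by
  unfold modelEntry; fun_prop

lemma measurable_modelTrace (u v w : ℂ) (p N : ℕ) : Measurable (modelTrace u v w p N) := by
  have := (measurable_trace_hermitianFill p N).comp
    (measurable_pi_lambda (fun g (k : {k : Fin N × Fin N // k.1 ≤ k.2}) => modelEntry u v w k.1 g)
      fun k => measurable_modelEntry u v w k.1)
  convert this using 1
  ext g
  simp only [modelTrace, gaussianMatrix_eq_hermitianFill, Function.comp_apply]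

lemma iIndepFun_modelEntry (u v w : ℂ) (N : ℕ) :
    iIndepFun (fun (k : {k : Fin N × Fin N // k.1 ≤ k.2}) => modelEntry u v w k.1)
      (Measure.pi fun _ : Fin N × Fin N => gaussianReal 0 1) := by
  -- the entry `k` only depends on the coordinates `k` and `k.swap`
  have h := iIndepFun_group (P := Measure.pi fun _ : Fin N × Fin N => gaussianReal 0 1)
    (K := {k : Fin N × Fin N // k.1 ≤ k.2})
    (κ := fun k => {c : Fin N × Fin N // c = k.1 ∨ c = k.1.swap})
    (f := fun i g => g i) (fun i => measurable_pi_apply i)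
    (iIndepFun_pi (X := fun _ x => x) fun _ => aemeasurable_id)
    (e := fun s => s.2.1) (by
      rintro ⟨⟨⟨i, j⟩, hij⟩, ⟨c, hc⟩⟩ ⟨⟨⟨i', j'⟩, hij'⟩, ⟨c', hc'⟩⟩ h
      simp only at h hij hij'
      subst h
      have : i = i' ∧ j = j' := by
        rcases hc with rfl | rfl <;> rcases hc' with h | h <;>
          simp only [Prod.swap_prod_mk, Prod.mk.injEq] at h <;> obtain ⟨h1, h2⟩ := h <;>
          constructor <;> apply Fin.ext <;> simp only [Fin.le_def, Fin.ext_iff] at * <;> omega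
      obtain ⟨rfl, rfl⟩ := this
      rfl)
  exact h.comp (g := fun k y => entryCoeff u (conj v) w k.1.1 k.1.2 * (y ⟨k.1, Or.inl rfl⟩ : ℝ) +
    entryCoeff v (conj u) (conj w) k.1.1 k.1.2 * (y ⟨k.1.swap, Or.inr rfl⟩ : ℝ)) fun k => by
      fun_prop

lemma map_modelEntry_diag (u v w : ℂ) {N : ℕ} (i : Fin N) :
    (Measure.pi fun _ : Fin N × Fin N => gaussianReal 0 1).map (modelEntry u v w (i, i)) =
      (gaussianReal 0 1).map fun x : ℝ => (w + conj w) * (x : ℂ) := by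
  have hm : (Measure.pi fun _ : Fin N × Fin N => gaussianReal 0 1).map (fun g => g (i, i)) =
      gaussianReal 0 1 :=
    (measurePreserving_eval (fun _ : Fin N × Fin N => gaussianReal 0 1) (i, i)).map_eq
  conv_rhs => rw [← hm]
  rw [Measure.map_map (by fun_prop) (by fun_prop)]
  congr 1
  ext g
  simp [modelEntry, entryCoeff, add_mul]

lemma map_modelEntry_off (u v w : ℂ) {N : ℕ} {i j : Fin N} (hij : i < j) :
    (Measure.pi fun _ : Fin N × Fin N => gaussianReal 0 1).map (modelEntry u v w (i, j)) =
      ((gaussianReal 0 1).prod (gaussianReal 0 1)).map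
        fun z : ℝ × ℝ => u * (z.1 : ℂ) + v * (z.2 : ℂ) := by
  have hind : iIndepFun (fun (k : Fin N × Fin N) (g : Fin N × Fin N → ℝ) => g k)
      (Measure.pi fun _ : Fin N × Fin N => gaussianReal 0 1) :=
    iIndepFun_pi (X := fun _ x => x) fun _ => aemeasurable_id
  have hne : (i, j) ≠ (j, i) := fun h => hij.ne (Prod.mk.inj h).1
  have h := (indepFun_iff_map_prod_eq_prod_map_map (measurable_pi_apply _).aemeasurable
    (measurable_pi_apply _).aemeasurable).1 (hind.indepFun hne)
  have hm : ∀ k, (Measure.pi fun _ : Fin N × Fin N => gaussianReal 0 1).map (fun g => g k) =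
      gaussianReal 0 1 := fun k =>
    (measurePreserving_eval (fun _ : Fin N × Fin N => gaussianReal 0 1) k).map_eq
  rw [hm, hm] at h
  rw [← h, Measure.map_map (by fun_prop) (by fun_prop)]
  congr 1
  ext g
  simp [modelEntry, entryCoeff, hij]

/-- The normalized trace of a Gaussian Wigner matrix has the law of its matrix model. -/
theorem measure_traceMoment_eq {Ω : Type*} [MeasurableSpace Ω] {P : Measure Ω}
    [IsProbabilityMeasure P] {X : ℕ → ℕ → Ω → ℂ} (hX : IsWigner P X) {u v w : ℂ}
    (hoff : P.map (X 0 1) = ((gaussianReal 0 1).prod (gaussianReal 0 1)).map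
        fun z : ℝ × ℝ => u * (z.1 : ℂ) + v * (z.2 : ℂ))
    (hdiag : P.map (X 0 0) = (gaussianReal 0 1).map fun x : ℝ => (w + conj w) * (x : ℂ))
    (p N : ℕ) :
    AEMeasurable (traceMoment X p N) P ∧ ∀ B : Set ℝ, MeasurableSet B →
      P {ω | traceMoment X p N ω ∈ B} =
        (Measure.pi fun _ : Fin N × Fin N => gaussianReal 0 1)
          {g | modelTrace u v w p N g ∈ B} := by
  have hmeas : ∀ i j : ℕ, i ≤ j → AEMeasurable (X i j) P := by
    intro i j hij
    rcases hij.eq_or_lt with rfl | hij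
    · exact (hX.ident_diag i).aemeasurable_fst
    · exact (hX.ident_offDiag i j hij).aemeasurable_fst
  set V : Ω → {k : Fin N × Fin N // k.1 ≤ k.2} → ℂ := fun ω k => X k.1.1 k.1.2 ω
  have hV : AEMeasurable V P := aemeasurable_pi_lambda _ fun k => hmeas _ _ k.2
  have hind : iIndepFun (fun (k : {k : Fin N × Fin N // k.1 ≤ k.2}) => X k.1.1 k.1.2) P := by
    refine hX.indep.precomp (g := fun k : {k : Fin N × Fin N // k.1 ≤ k.2} =>
      (⟨((k.1.1 : ℕ), (k.1.2 : ℕ)), k.2⟩ : {k : ℕ × ℕ // k.1 ≤ k.2})) ?_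
    rintro ⟨⟨i, j⟩, h⟩ ⟨⟨i', j'⟩, h'⟩ hh
    simpa [Fin.ext_iff] using hh
  have hlaw : P.map V = (Measure.pi fun _ : Fin N × Fin N => gaussianReal 0 1).map
      (fun g k => modelEntry u v w k.1 g) := by
    have e1 := (iIndepFun_iff_map_fun_eq_pi_map
      (f := fun (k : {k : Fin N × Fin N // k.1 ≤ k.2}) => X k.1.1 k.1.2)
      fun k => hmeas _ _ k.2).1 hind
    have e2 := (iIndepFun_iff_map_fun_eq_pi_map
      (f := fun (k : {k : Fin N × Fin N // k.1 ≤ k.2}) => modelEntry u v w k.1)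
      fun k => (measurable_modelEntry u v w k.1).aemeasurable).1 (iIndepFun_modelEntry u v w N)
    refine e1.trans (Eq.trans ?_ e2.symm)
    congr 1
    ext1 ⟨⟨i, j⟩, hij⟩
    simp only at hij ⊢
    rcases hij.eq_or_lt with rfl | hij
    · rw [(hX.ident_diag i).map_eq, hdiag, map_modelEntry_diag]
    · rw [(hX.ident_offDiag i j hij).map_eq, hoff, map_modelEntry_off u v w hij]
  have htr : traceMoment X p N = fun ω =>
      1 / (N : ℝ) * ((((1 / (√N : ℂ)) • hermitianFill (V ω)) ^ p).trace).re := by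
    ext ω
    have : normalizedMatrix X N ω = (1 / (√N : ℂ)) • hermitianFill (V ω) := by
      ext i j
      simp only [normalizedMatrix, Matrix.of_apply, hermitianFill, Matrix.smul_apply,
        smul_eq_mul, V]
      by_cases h : i ≤ j
      · simp only [h, dif_pos]; ring
      · simp only [h, dif_neg, not_false_eq_true, ← hX.hermitian]; ring
    rw [traceMoment, this]
  refine ⟨htr ▸ (measurable_trace_hermitianFill p N).comp_aemeasurable hV, fun B hB => ?_⟩
  have hS := measurable_trace_hermitianFill p N hB
  have hE : Measurable fun g (k : {k : Fin N × Fin N // k.1 ≤ k.2}) => modelEntry u v w k.1 g :=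
    measurable_pi_lambda _ fun k => measurable_modelEntry u v w k.1
  have h1 := Measure.map_apply_of_aemeasurable hV hS
  rw [hlaw, Measure.map_apply hE hS] at h1
  rw [htr]
  simp only [modelTrace, gaussianMatrix_eq_hermitianFill]
  exact h1.symm

lemma map_diag_of_isRealGaussian {Ω : Type*} [MeasurableSpace Ω] {P : Measure Ω} {Y : Ω → ℂ}
    {s : ℝ≥0} (h : IsRealGaussian P (s ^ 2) Y) :
    P.map Y = (gaussianReal 0 1).map fun x : ℝ => ((s : ℝ) : ℂ) * (x : ℂ) := by
  have h1 : Y =ᵐ[P] fun ω => (((Y ω).re : ℝ) : ℂ) := by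
    filter_upwards [h.2] with ω hω
    exact Complex.ext (by simp) (by simp [hω])
  have h2 : gaussianReal 0 (s ^ 2) = (gaussianReal 0 1).map fun x => (s : ℝ) * x := by
    rw [gaussianReal_map_const_mul]
    congr 1
    · simp
    · ext; simp
  rw [Measure.map_congr h1, show (fun ω => (((Y ω).re : ℝ) : ℂ)) =
    (fun x : ℝ => (x : ℂ)) ∘ fun ω => (Y ω).re from rfl,
    ← AEMeasurable.map_map_of_aemeasurable (by fun_prop) h.1.aemeasurable, h.1.map_eq, h2,
    Measure.map_map (by fun_prop) (by fun_prop)]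
  congr 1
  ext x
  simp

lemma map_off_of_isRealGaussian {Ω : Type*} [MeasurableSpace Ω] {P : Measure Ω} {Y : Ω → ℂ}
    (h : IsRealGaussian P 1 Y) :
    P.map Y = ((gaussianReal 0 1).prod (gaussianReal 0 1)).map
      fun z : ℝ × ℝ => (1 : ℂ) * (z.1 : ℂ) + 0 * (z.2 : ℂ) := by
  have h1 := map_diag_of_isRealGaussian (s := 1) (by simpa using h)
  rw [h1]
  have h2 : (gaussianReal 0 1) = ((gaussianReal 0 1).prod (gaussianReal 0 1)).map Prod.fst := by
    rw [Measure.map_fst_prod]; simp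
  conv_lhs => rw [h2]
  rw [Measure.map_map (by fun_prop) (by fun_prop)]
  congr 1
  ext z
  simp

lemma map_off_of_isStdComplexGaussian {Ω : Type*} [MeasurableSpace Ω] {P : Measure Ω}
    [IsProbabilityMeasure P] {Y : Ω → ℂ} (h : IsStdComplexGaussian P Y) :
    P.map Y = ((gaussianReal 0 1).prod (gaussianReal 0 1)).map
      fun z : ℝ × ℝ => (1 / √2 : ℂ) * (z.1 : ℂ) + (Complex.I / √2) * (z.2 : ℂ) := by
  obtain ⟨hre, him, hind⟩ := h
  have h2 : gaussianReal 0 (1 / 2) = (gaussianReal 0 1).map fun x => (1 / √2) * x := by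
    rw [gaussianReal_map_const_mul]
    congr 1
    · simp
    · ext; simp
  have h3 := (indepFun_iff_map_prod_eq_prod_map_map hre.aemeasurable him.aemeasurable).1 hind
  rw [hre.map_eq, him.map_eq, h2, Measure.map_prod_map _ _ (by fun_prop) (by fun_prop)] at h3
  have h4 : Y = (fun z : ℝ × ℝ => (z.1 : ℂ) + (z.2 : ℂ) * Complex.I) ∘
      fun ω => ((Y ω).re, (Y ω).im) := by
    ext ω
    simp [Complex.re_add_im]
  rw [h4, ← AEMeasurable.map_map_of_aemeasurable (by fun_prop)
    (hre.aemeasurable.prodMk him.aemeasurable), h3, Measure.map_map (by fun_prop) (by fun_prop)]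
  congr 1
  ext z
  simp
  ring

/-! ### Asymptotics of the trace of a perturbed Gaussian matrix -/

section Asymptotics

open scoped Matrix Matrix.Norms.L2Operator

lemma eventually_const_mul_rpow_le (C : ℝ) {a b : ℝ} (hab : a < b) :
    ∀ᶠ N : ℕ in atTop, C * (N : ℝ) ^ a ≤ (N : ℝ) ^ b := by
  have h := (tendsto_rpow_atTop (sub_pos.2 hab)).comp tendsto_natCast_atTop_atTop
  filter_upwards [h.eventually_ge_atTop C, eventually_gt_atTop 0] with N hN hN0
  have hN0' : (0 : ℝ) < N := by exact_mod_cast hN0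
  calc C * (N : ℝ) ^ a ≤ (N : ℝ) ^ (b - a) * (N : ℝ) ^ a := by gcongr; exact hN
    _ = (N : ℝ) ^ b := by rw [← Real.rpow_add hN0']; congr 1; ring

/-- A perturbation of Hilbert–Schmidt norm `O(N ^ (1 / p))` changes the trace of the `p`-th power
of a matrix of operator norm at most `N ^ (1 / (8 p))` by its own trace, up to `o(N)`. -/
lemma eventually_norm_trace_add_pow_sub_le {p : ℕ} (hp : 3 ≤ p) {R η : ℝ} (hR : 0 ≤ R)
    (hη : 0 < η) : ∀ᶠ N : ℕ in atTop, ∀ Y H : Matrix (Fin N) (Fin N) ℂ,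
      ‖Y‖ ≤ (N : ℝ) ^ (1 / (8 * p : ℝ)) → hsNorm H ≤ R * (N : ℝ) ^ (1 / (p : ℝ)) →
      ‖((Y + H) ^ p).trace - (Y ^ p).trace - (H ^ p).trace‖ ≤ η * N := by
  have hp' : (3 : ℝ) ≤ p := by exact_mod_cast hp
  have hp0 : (0 : ℝ) < p := by linarith
  have hp1 : 1 / (p : ℝ) ≤ 1 / 3 := one_div_le_one_div_of_le (by norm_num) hp'
  have hp2 : 0 < 1 / (p : ℝ) := by positivity
  set δ : ℝ := 1 / (8 * p : ℝ) with hδ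
  have hδ8 : δ = 1 / 8 * (1 / (p : ℝ)) := by rw [hδ]; field_simp
  have hcast1 : ((p - 1 : ℕ) : ℝ) = p - 1 := by rw [Nat.cast_sub (by omega)]; simp
  have hcast2 : ((p - 2 : ℕ) : ℝ) = p - 2 := by rw [Nat.cast_sub (by omega)]; simp
  have hpp : (p : ℝ) * (1 / p) = 1 := by field_simp
  set θ₁ : ℝ := 1 / 2 + δ * (p - 1 : ℕ) + 1 / p with hθ₁
  set θ₂ : ℝ := δ + 1 / p + 1 / p * (p - 2 : ℕ) with hθ₂
  have h1 : θ₁ < 1 := by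
    rw [hθ₁, hcast1, hδ8]; nlinarith
  have h2 : θ₂ < 1 := by
    rw [hθ₂, hcast2, hδ8]; nlinarith
  filter_upwards [eventually_const_mul_rpow_le (p ^ 2 * R * (2 / η)) h1,
    eventually_const_mul_rpow_le (p ^ 2 * R * (1 + R) ^ (p - 2) * (2 / η)) h2,
    eventually_ge_atTop 1] with N e1 e2 hN Y H hY hH
  have hN1 : (1 : ℝ) ≤ N := by exact_mod_cast hN
  have hN0 : (0 : ℝ) < N := by linarith
  have hh := hsNorm_nonneg H
  have hy := norm_nonneg Y
  rw [Real.rpow_one] at e1 e2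
  set n : ℝ := (N : ℝ) ^ δ
  set m : ℝ := (N : ℝ) ^ (1 / (p : ℝ))
  have hn0 : 0 < n := by positivity
  have hm0 : 0 < m := by positivity
  have hnm : n ≤ m := Real.rpow_le_rpow_of_exponent_le hN1 (by rw [hδ8]; linarith)
  refine (norm_trace_add_pow_sub_le Y H (by omega)).trans ?_
  rw [Fintype.card_fin]
  have t1 : √N * ‖Y‖ ^ (p - 1) * hsNorm H ≤ R * (N : ℝ) ^ θ₁ := by
    calc √N * ‖Y‖ ^ (p - 1) * hsNorm H ≤ √N * n ^ (p - 1) * (R * m) := by gcongr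
      _ = R * (N : ℝ) ^ θ₁ := by
        rw [hθ₁, Real.rpow_add hN0, Real.rpow_add hN0, Real.rpow_mul hN0.le, Real.rpow_natCast,
          ← Real.sqrt_eq_rpow]
        ring
  have t2 : ‖Y‖ * hsNorm H * (‖Y‖ + hsNorm H) ^ (p - 2) ≤
      R * (1 + R) ^ (p - 2) * (N : ℝ) ^ θ₂ := by
    calc ‖Y‖ * hsNorm H * (‖Y‖ + hsNorm H) ^ (p - 2)
        ≤ n * (R * m) * ((1 + R) * m) ^ (p - 2) := by
          gcongr
          linarith
      _ = R * (1 + R) ^ (p - 2) * (N : ℝ) ^ θ₂ := by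
        rw [hθ₂, Real.rpow_add hN0, Real.rpow_add hN0, Real.rpow_mul hN0.le (1 / (p : ℝ)),
          Real.rpow_natCast, mul_pow]
        ring
  have s1 : p ^ 2 * R * (N : ℝ) ^ θ₁ ≤ η / 2 * N := by
    calc p ^ 2 * R * (N : ℝ) ^ θ₁ = η / 2 * (p ^ 2 * R * (2 / η) * (N : ℝ) ^ θ₁) := by
          field_simp
      _ ≤ η / 2 * N := by gcongr
  have s2 : p ^ 2 * R * (1 + R) ^ (p - 2) * (N : ℝ) ^ θ₂ ≤ η / 2 * N := by
    calc p ^ 2 * R * (1 + R) ^ (p - 2) * (N : ℝ) ^ θ₂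
        = η / 2 * (p ^ 2 * R * (1 + R) ^ (p - 2) * (2 / η) * (N : ℝ) ^ θ₂) := by field_simp
      _ ≤ η / 2 * N := by gcongr
  have := mul_le_mul_of_nonneg_left (add_le_add t1 t2) (by positivity : (0 : ℝ) ≤ p ^ 2)
  nlinarith

/-- The matrix model divided by `√N`. -/
noncomputable def modelMatrix (u v w : ℂ) {N : ℕ} (g : Fin N × Fin N → ℝ) :
    Matrix (Fin N) (Fin N) ℂ :=
  (1 / (√N : ℂ)) • gaussianMatrix u v w fun k => (g k : ℂ)

lemma modelTrace_eq (u v w : ℂ) (p N : ℕ) (g : Fin N × Fin N → ℝ) :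
    modelTrace u v w p N g = 1 / N * ((modelMatrix u v w g ^ p).trace).re := rfl

lemma modelMatrix_add (u v w : ℂ) {N : ℕ} (g h : Fin N × Fin N → ℝ) :
    modelMatrix u v w (g + h) = modelMatrix u v w g + modelMatrix u v w h := by
  ext i j
  simp only [modelMatrix, gaussianMatrix, Matrix.smul_apply, Matrix.of_apply, Matrix.add_apply,
    Pi.add_apply, Complex.ofReal_add, smul_eq_mul]
  ring

lemma modelMatrix_eq_add_diagonal (u v w w₀ : ℂ) {N : ℕ} (g : Fin N × Fin N → ℝ) :
    modelMatrix u v w g = modelMatrix u v w₀ g + (1 / (√N : ℂ)) •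
      Matrix.diagonal fun i => (w + conj w - (w₀ + conj w₀)) * (g (i, i) : ℂ) := by
  rw [modelMatrix, modelMatrix, ← smul_add]
  congr 1
  ext i j
  simp only [gaussianMatrix, Matrix.of_apply, Matrix.add_apply, Matrix.diagonal_apply, smul_eq_mul]
  unfold entryCoeff
  rcases lt_trichotomy i j with h | rfl | h
  · simp [h, h.ne]
  · simp; ring
  · simp [h, h.not_gt, h.ne']

lemma hsNorm_smul_diagonal_sq {N : ℕ} (hN : 0 < N) (c : ℂ) (x : Fin N → ℝ) :
    hsNorm ((1 / (√N : ℂ)) • Matrix.diagonal fun i => c * (x i : ℂ)) ^ 2 =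
      ‖c‖ ^ 2 * (∑ i, x i ^ 2) / N := by
  have hN' : (0 : ℝ) < N := by exact_mod_cast hN
  have h1 : ‖(1 / (√N : ℂ))‖ ^ 2 = 1 / N := by
    rw [norm_div, norm_one, Complex.norm_real, div_pow, Real.norm_eq_abs, sq_abs,
      Real.sq_sqrt hN'.le, one_pow]
  rw [hsNorm_smul, mul_pow, h1, hsNorm_sq]
  have h2 : ∀ i, ∑ j, ‖(Matrix.diagonal fun i => c * (x i : ℂ)) i j‖ ^ 2 = ‖c‖ ^ 2 * x i ^ 2 := by
    intro i
    rw [Finset.sum_eq_single i]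
    · simp [mul_pow]
    · intro j _ hj
      simp [Matrix.diagonal_apply_ne' _ hj]
    · simp
  simp only [h2, ← Finset.mul_sum]
  ring

lemma measure_sum_diag_sq_le {N : ℕ} (hN : 0 < N) :
    (Measure.pi fun _ : Fin N × Fin N => gaussianReal 0 1).real
      {g | 16 * (N : ℝ) ≤ ∑ i, g (i, i) ^ 2} ≤ 1 / 16 := by
  set γ := Measure.pi fun _ : Fin N × Fin N => gaussianReal 0 1
  have hN' : (0 : ℝ) < N := by exact_mod_cast hN
  have hmp := fun i : Fin N =>
    measurePreserving_eval (fun _ : Fin N × Fin N => gaussianReal 0 1) (i, i)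
  have hint : ∀ i : Fin N, Integrable (fun g : Fin N × Fin N → ℝ => g (i, i) ^ 2) γ := fun i =>
    (hmp i).integrable_comp_of_integrable (integrable_pow_gaussianReal 2)
  have hval : ∀ i : Fin N, ∫ g, g (i, i) ^ 2 ∂γ = 1 := by
    intro i
    have h1 : ∫ g, g (i, i) ^ 2 ∂γ = ∫ x, x ^ 2 ∂gaussianReal 0 1 := by
      rw [← (hmp i).map_eq, integral_map (hmp i).measurable.aemeasurable (by fun_prop)]
    rw [h1, integral_pow_succ_gaussianReal 1]
    simp
  have h := mul_meas_ge_le_integral_of_nonneg (μ := γ)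
    (ae_of_all _ fun g => by positivity : 0 ≤ᵐ[γ] fun g => ∑ i, g (i, i) ^ 2)
    (integrable_finsetSum _ fun i _ => hint i) (16 * N)
  rw [integral_finsetSum _ fun i _ => hint i] at h
  simp only [hval, Finset.sum_const, Finset.card_univ, Fintype.card_fin, nsmul_eq_mul,
    mul_one] at h
  nlinarith

/-- With probability at least `3 / 4`, the matrix model has the trace predicted by Wigner's
theorem and an operator norm at most `N ^ (1 / (8 p))`; the latter follows from Wigner's theorem for
a large even power. The diagonal entries need not have the variance of an invariant ensemble:
changing it is a perturbation of bounded Hilbert–Schmidt norm. -/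
lemma eventually_exists_typical_set {u v w₀ τ : ℂ} (h : IsEnsembleCoeff u v w₀ τ) (w : ℂ) {p : ℕ}
    (hp : 3 ≤ p) {ε : ℝ} (hε : 0 < ε) : ∀ᶠ N : ℕ in atTop, ∃ A : Set (Fin N × Fin N → ℝ),
      MeasurableSet A ∧ 3 / 4 ≤ (Measure.pi fun _ : Fin N × Fin N => gaussianReal 0 1).real A ∧
      ∀ g ∈ A, |modelTrace u v w p N g - semicircleMoment p| ≤ ε ∧
        ‖modelMatrix u v w g‖ ≤ (N : ℝ) ^ (1 / (8 * p : ℝ)) := by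
  have hp0 : (0 : ℝ) < p := by positivity
  set δ : ℝ := 1 / (8 * p : ℝ) with hδ
  have hδ0 : 0 < δ := by positivity
  -- an even power so large that `tr Y ^ q = O(N)` gives `‖Y‖ = O(N ^ (1 / q))`, with `1 / q < δ`
  set q : ℕ := 2 * 2 ^ (16 * p) with hq
  have hq2 : 2 ≤ δ * q := by
    have h1 : (16 * p : ℕ) ≤ 2 ^ (16 * p) := Nat.lt_two_pow_self.le
    have h2 : ((16 * p : ℕ) : ℝ) ≤ q := by exact_mod_cast h1.trans (by omega)
    rw [hδ, div_mul_eq_mul_div, le_div_iff₀ (by positivity)]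
    push_cast at h2
    linarith
  set c : ℝ := ‖w + conj w - (w₀ + conj w₀)‖
  set K : ℝ := semicircleMoment q + 1
  have ev1 := (tendsto_measure_modelTrace h p (ε := ε / 3) (by positivity)).eventually_le_const
    (by norm_num : (0 : ℝ) < 1 / 16)
  have ev2 := (tendsto_measure_modelTrace h q (ε := 1) one_pos).eventually_le_const
    (by norm_num : (0 : ℝ) < 1 / 16)
  have ev3 := eventually_norm_trace_add_pow_sub_le hp (R := 4 * c) (η := ε / 3) (by positivity)
    (by positivity)
  have ev4 := eventually_const_mul_rpow_le (2 ^ q * K) (by norm_num : (1 : ℝ) < 2)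
  have ev5 := eventually_const_mul_rpow_le (8 * c) hδ0
  have ev6 := eventually_const_mul_rpow_le ((4 * c) ^ p * (3 / ε)) (by norm_num : (0 : ℝ) < 1)
  filter_upwards [ev1, ev2, ev3, ev4, ev5, ev6, eventually_ge_atTop 1] with
    N e1 e2 e3 e4 e5 e6 hN
  have hN1 : (1 : ℝ) ≤ N := by exact_mod_cast hN
  have hN0 : (0 : ℝ) < N := by linarith
  rw [Real.rpow_zero, mul_one] at e5 e6
  rw [Real.rpow_one] at e4 e6
  have hm := measurable_modelTrace u v w₀
  set γ := Measure.pi fun _ : Fin N × Fin N => gaussianReal 0 1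
  set B₁ : Set (Fin N × Fin N → ℝ) := {g | ε / 3 ≤ |modelTrace u v w₀ p N g - semicircleMoment p|}
  set B₂ : Set (Fin N × Fin N → ℝ) := {g | 1 ≤ |modelTrace u v w₀ q N g - semicircleMoment q|}
  set B₃ : Set (Fin N × Fin N → ℝ) := {g | 16 * (N : ℝ) ≤ ∑ i, g (i, i) ^ 2}
  have hB₁ : MeasurableSet B₁ :=
    measurableSet_le measurable_const (((hm p N).sub_const _).abs)
  have hB₂ : MeasurableSet B₂ :=
    measurableSet_le measurable_const (((hm q N).sub_const _).abs)
  have hB₃ : MeasurableSet B₃ := measurableSet_le measurable_const (by fun_prop)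
  -- the complement of three exceptional events of probability at most `1 / 16` each
  refine ⟨(B₁ ∪ B₂ ∪ B₃)ᶜ, ((hB₁.union hB₂).union hB₃).compl, ?_, ?_⟩
  · rw [probReal_compl_eq_one_sub ((hB₁.union hB₂).union hB₃)]
    have h1 := measureReal_union_le (μ := γ) (B₁ ∪ B₂) B₃
    have h2 := measureReal_union_le (μ := γ) B₁ B₂
    have h3 : γ.real B₃ ≤ 1 / 16 := measure_sum_diag_sq_le hN
    linarith
  · intro g hg
    simp only [Set.mem_compl_iff, Set.mem_union, not_or, B₁, B₂, B₃, Set.mem_ofPred_eq,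
      not_le] at hg
    obtain ⟨⟨g1, g2⟩, g3⟩ := hg
    set Y := modelMatrix u v w₀ g
    set H := (1 / (√N : ℂ)) •
      Matrix.diagonal fun i => (w + conj w - (w₀ + conj w₀)) * (g (i, i) : ℂ) with hH
    have hHs : hsNorm H ≤ 4 * c := by
      refine abs_le_of_sq_le_sq' ?_ (by positivity) |>.2
      rw [hH, hsNorm_smul_diagonal_sq hN, div_le_iff₀ hN0]
      have := mul_le_mul_of_nonneg_left g3.le (sq_nonneg c)
      nlinarith
    have hYop : ‖Y‖ ≤ (N : ℝ) ^ δ / 2 := by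
      have hq0 : q ≠ 0 := by positivity
      refine (pow_le_pow_iff_left₀ (norm_nonneg _) (by positivity) hq0).1 ?_
      have h1 : ‖Y‖ ^ q ≤ ((Y ^ q).trace).re :=
        opNorm_pow_le_trace (isHermitian_smul_gaussianMatrix u v w₀ g) _
      have h2 : ((Y ^ q).trace).re = N * modelTrace u v w₀ q N g := by
        rw [modelTrace_eq]; field_simp; rfl
      have h3 : modelTrace u v w₀ q N g ≤ K := by
        have := (abs_lt.1 g2).2
        simp only [K]; linarith
      have h4 : (N : ℝ) ^ (2 : ℝ) ≤ (N : ℝ) ^ (δ * q) :=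
        Real.rpow_le_rpow_of_exponent_le hN1 hq2
      rw [div_pow, ← Real.rpow_natCast ((N : ℝ) ^ δ), ← Real.rpow_mul hN0.le,
        le_div_iff₀ (by positivity)]
      calc ‖Y‖ ^ q * 2 ^ q ≤ (N * K) * 2 ^ q := by
            gcongr
            rw [h2] at h1
            exact h1.trans (by gcongr)
        _ = 2 ^ q * K * N := by ring
        _ ≤ _ := e4.trans h4
    have hYN : ‖Y‖ ≤ (N : ℝ) ^ δ := hYop.trans (half_le_self (by positivity))
    have hHN : hsNorm H ≤ 4 * c * (N : ℝ) ^ (1 / (p : ℝ)) :=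
      hHs.trans (le_mul_of_one_le_right (by positivity)
        (Real.one_le_rpow hN1 (by positivity)))
    have hL : modelMatrix u v w g = Y + H := modelMatrix_eq_add_diagonal u v w w₀ g
    refine ⟨?_, ?_⟩
    · have t1 := e3 Y H hYN hHN
      have t2 : ‖(H ^ p).trace‖ ≤ ε / 3 * N := by
        obtain ⟨k, rfl⟩ : ∃ k, p = k + 2 := ⟨p - 2, by omega⟩
        refine (norm_trace_pow_le H k).trans
          ((pow_le_pow_left₀ (hsNorm_nonneg H) hHs _).trans ?_)
        have := mul_le_mul_of_nonneg_left e6 (by positivity : 0 ≤ ε / 3)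
        refine le_trans (le_of_eq ?_) this
        field_simp
      have t3 : ‖((Y + H) ^ p).trace - (Y ^ p).trace‖ ≤ 2 * (ε / 3) * N := by
        have := norm_add_le (((Y + H) ^ p).trace - (Y ^ p).trace - (H ^ p).trace) (H ^ p).trace
        rw [sub_add_cancel] at this
        linarith
      have t4 := (Complex.abs_re_le_norm _).trans t3
      rw [Complex.sub_re] at t4
      have t5 : |modelTrace u v w p N g - modelTrace u v w₀ p N g| ≤ 2 * (ε / 3) := by
        rw [modelTrace_eq, modelTrace_eq, hL, ← mul_sub, abs_mul, abs_of_pos (by positivity),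
          one_div, inv_mul_le_iff₀ hN0]
        linarith
      have := abs_sub_le (modelTrace u v w p N g) (modelTrace u v w₀ p N g) (semicircleMoment p)
      linarith
    · rw [hL]
      refine (norm_add_le _ _).trans ?_
      have := (opNorm_le_hsNorm H).trans hHs
      linarith

/-- A translation of a typical point changes the trace by the trace of the translation alone. -/
lemma eventually_exists_typical_set_translate {u v w₀ τ : ℂ} (h : IsEnsembleCoeff u v w₀ τ)
    (w : ℂ) {p : ℕ} (hp : 3 ≤ p) {R ε : ℝ} (hR : 0 ≤ R) (hε : 0 < ε) :
    ∀ᶠ N : ℕ in atTop, ∃ A : Set (Fin N × Fin N → ℝ),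
      MeasurableSet A ∧ 3 / 4 ≤ (Measure.pi fun _ : Fin N × Fin N => gaussianReal 0 1).real A ∧
      ∀ x ∈ A, ∀ y, hsNorm (modelMatrix u v w y) ≤ R * (N : ℝ) ^ (1 / (p : ℝ)) →
        |modelTrace u v w p N (x + y) - (semicircleMoment p + modelTrace u v w p N y)| ≤ ε := by
  filter_upwards [eventually_exists_typical_set h w hp (ε := ε / 2) (by positivity),
    eventually_norm_trace_add_pow_sub_le hp hR (η := ε / 2) (by positivity),
    eventually_ge_atTop 1] with N ⟨A, hA, hA2, hA3⟩ e hN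
  have hN0 : (0 : ℝ) < N := by exact_mod_cast hN
  refine ⟨A, hA, hA2, fun x hx y hy => ?_⟩
  obtain ⟨h1, h2⟩ := hA3 x hx
  have t := (Complex.abs_re_le_norm _).trans (e _ _ h2 hy)
  rw [Complex.sub_re, Complex.sub_re, ← modelMatrix_add] at t
  have t2 : |modelTrace u v w p N (x + y) - modelTrace u v w p N x - modelTrace u v w p N y| ≤
      ε / 2 := by
    simp only [modelTrace_eq]
    rw [← mul_sub, ← mul_sub, abs_mul, abs_of_pos (by positivity), one_div, inv_mul_le_iff₀ hN0]
    linarith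
  have := abs_add_le (modelTrace u v w p N (x + y) - modelTrace u v w p N x -
    modelTrace u v w p N y) (modelTrace u v w p N x - semicircleMoment p)
  rw [show modelTrace u v w p N (x + y) - (semicircleMoment p + modelTrace u v w p N y) =
    (modelTrace u v w p N (x + y) - modelTrace u v w p N x - modelTrace u v w p N y) +
      (modelTrace u v w p N x - semicircleMoment p) by ring]
  linarith

end Asymptotics

/-! ### Probability bounds for the matrix model -/

/-- A shift of the Gaussian vector by `g` has cost at least `κ N ‖H‖ ^ 2`, with `H` the shift of the
normalized matrix, in Hilbert–Schmidt norm. -/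
lemma const_mul_hsNorm_modelMatrix_sq_le {u v w : ℂ} {κ : ℝ}
    (hoff : ∀ a b : ℝ, 2 * κ * ‖u * a + v * b‖ ^ 2 ≤ a ^ 2 + b ^ 2)
    (hdiag : κ * ‖w + conj w‖ ^ 2 ≤ 1) {N : ℕ} (hN : 0 < N) (g : Fin N × Fin N → ℝ) :
    κ * (N * hsNorm (modelMatrix u v w g) ^ 2) ≤ ∑ k, g k ^ 2 := by
  have hN' : (0 : ℝ) < N := by exact_mod_cast hN
  have h1 : ‖(1 / (√N : ℂ))‖ ^ 2 = 1 / N := by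
    rw [norm_div, norm_one, Complex.norm_real, div_pow, Real.norm_eq_abs, sq_abs,
      Real.sq_sqrt hN'.le, one_pow]
  have h2 : ∀ i j, κ * ‖gaussianMatrix u v w (fun k => (g k : ℂ)) i j‖ ^ 2 ≤
      (g (i, j) ^ 2 + g (j, i) ^ 2) / 2 := by
    intro i j
    rcases lt_trichotomy i j with h | rfl | h
    · have := hoff (g (i, j)) (g (j, i))
      simp only [gaussianMatrix, entryCoeff, Matrix.of_apply, h, if_true, smul_eq_mul]
      linarith
    · simp only [gaussianMatrix, entryCoeff, Matrix.of_apply, lt_irrefl, if_false, smul_eq_mul]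
      rw [← add_mul, norm_mul, Complex.norm_real, mul_pow, Real.norm_eq_abs, sq_abs]
      have := mul_le_mul_of_nonneg_right hdiag (sq_nonneg (g (i, i)))
      linarith
    · rw [← (isHermitian_gaussianMatrix u v w g).apply, norm_star]
      have := hoff (g (j, i)) (g (i, j))
      simp only [gaussianMatrix, entryCoeff, Matrix.of_apply, h, if_true, smul_eq_mul]
      linarith
  have h3 : ∑ k, g k ^ 2 = ∑ i, ∑ j, (g (i, j) ^ 2 + g (j, i) ^ 2) / 2 := by
    have hc : ∑ i : Fin N, ∑ j : Fin N, g (j, i) ^ 2 = ∑ i, ∑ j, g (i, j) ^ 2 := Finset.sum_comm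
    simp only [← Finset.sum_div, Finset.sum_add_distrib, hc, Fintype.sum_prod_type]
    ring
  rw [modelMatrix, hsNorm_smul, mul_pow, h1, hsNorm_sq, h3,
    show ∀ x : ℝ, κ * (N * (1 / N * x)) = κ * x from fun x => by field_simp, Finset.mul_sum]
  refine Finset.sum_le_sum fun i _ => ?_
  rw [Finset.mul_sum]
  exact Finset.sum_le_sum fun j _ => h2 i j

/-- The trace of a shift is bounded by the power of its Hilbert–Schmidt norm, and nonnegative for
even powers. -/
lemma abs_modelTrace_le (u v w : ℂ) {p N : ℕ} (hp : 2 ≤ p) (hN : 0 < N) {R : ℝ}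
    {g : Fin N × Fin N → ℝ} (hg : hsNorm (modelMatrix u v w g) ≤ R * (N : ℝ) ^ (1 / (p : ℝ))) :
    |modelTrace u v w p N g| ≤ R ^ p ∧ (Even p → 0 ≤ modelTrace u v w p N g) := by
  have hN' : (0 : ℝ) < N := by exact_mod_cast hN
  have hp0 : (p : ℝ) ≠ 0 := by positivity
  refine ⟨?_, ?_⟩
  · obtain ⟨k, rfl⟩ : ∃ k, p = k + 2 := ⟨p - 2, by omega⟩
    rw [modelTrace_eq, abs_mul, abs_of_pos (by positivity), one_div, inv_mul_le_iff₀ hN']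
    calc |((modelMatrix u v w g ^ (k + 2)).trace).re|
        ≤ hsNorm (modelMatrix u v w g) ^ (k + 2) :=
          (Complex.abs_re_le_norm _).trans (norm_trace_pow_le _ k)
      _ ≤ (R * (N : ℝ) ^ (1 / ((k + 2 : ℕ) : ℝ))) ^ (k + 2) :=
          pow_le_pow_left₀ (hsNorm_nonneg _) hg _
      _ = N * R ^ (k + 2) := by
          rw [mul_pow, ← Real.rpow_natCast ((N : ℝ) ^ _), ← Real.rpow_mul hN'.le,
            one_div_mul_cancel hp0, Real.rpow_one, mul_comm]
  · rintro ⟨k, rfl⟩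
    have hH : (modelMatrix u v w g).IsHermitian := isHermitian_smul_gaussianMatrix u v w g
    rw [modelTrace_eq, ← two_mul, re_trace_pow_two_mul hH]
    positivity

/-- Upper bound for sets at positive distance from the traces reachable by shifts of Gaussian
cost less than `κ R² N ^ (1 + 2 / p) / 2`. -/
theorem eventually_measure_modelTrace_le {u v w₀ τ w : ℂ} (h : IsEnsembleCoeff u v w₀ τ) {κ : ℝ}
    (hκ : 0 < κ) (hoff : ∀ a b : ℝ, 2 * κ * ‖u * a + v * b‖ ^ 2 ≤ a ^ 2 + b ^ 2)
    (hdiag : κ * ‖w + conj w‖ ^ 2 ≤ 1) {p : ℕ} (hp : 3 ≤ p) {R ε : ℝ} (hR : 0 ≤ R) (hε : 0 < ε)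
    {B : Set ℝ} (hB : MeasurableSet B)
    (hBR : ∀ s, |s| ≤ R ^ p → (Even p → 0 ≤ s) → ∀ y ∈ B, ε < |y - (semicircleMoment p + s)|)
    {t : ℝ} (ht0 : 0 < t) (ht1 : t < 1) : ∀ᶠ N : ℕ in atTop,
      (Measure.pi fun _ : Fin N × Fin N => gaussianReal 0 1) {g | modelTrace u v w p N g ∈ B} ≤
        ENNReal.ofReal (2 ^ ((1 - t) / t) *
          Real.exp (-((1 - t) * (κ * R ^ 2 * (N : ℝ) ^ (1 + 2 / (p : ℝ))) / 2))) := by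
  filter_upwards [eventually_exists_typical_set_translate h w hp hR hε, eventually_ge_atTop 1] with
    N ⟨A, hA, hA2, hA3⟩ hN
  have hN0 : (0 : ℝ) < N := by exact_mod_cast hN
  refine gaussian_measure_le_of_far ht0 ht1 hA ((measurable_modelTrace u v w p N) hB) ?_ ?_
  · rw [← ofReal_measureReal]
    refine le_trans ?_ (ENNReal.ofReal_le_ofReal hA2)
    rw [← ENNReal.ofReal_one, ← ENNReal.ofReal_ofNat, ← ENNReal.ofReal_div_of_pos (by norm_num)]
    exact ENNReal.ofReal_le_ofReal (by norm_num)
  · intro x hx y hy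
    by_contra! hlt
    -- a cheaper translation `y - x` has a trace `s` excluded by the hypothesis on `B`
    have hg := const_mul_hsNorm_modelMatrix_sq_le hoff hdiag hN (y - x)
    have hsum : ∑ k, (y - x) k ^ 2 = ∑ k, (x k - y k) ^ 2 :=
      Finset.sum_congr rfl fun k _ => by simp only [Pi.sub_apply]; ring
    have hpow : (N : ℝ) ^ (1 + 2 / (p : ℝ)) = N * ((N : ℝ) ^ (1 / (p : ℝ))) ^ 2 := by
      rw [Real.rpow_add hN0, Real.rpow_one, ← Real.rpow_natCast ((N : ℝ) ^ _),
        ← Real.rpow_mul hN0.le]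
      congr 2
      push_cast
      ring
    rw [hsum] at hg
    have hs : hsNorm (modelMatrix u v w (y - x)) ≤ R * (N : ℝ) ^ (1 / (p : ℝ)) := by
      refine abs_le_of_sq_le_sq' ?_ (by positivity) |>.2
      have h1 : κ * N * hsNorm (modelMatrix u v w (y - x)) ^ 2 ≤
          κ * N * (R * (N : ℝ) ^ (1 / (p : ℝ))) ^ 2 := by
        rw [hpow] at hlt
        refine (le_of_eq (by ring)).trans (hg.trans (hlt.le.trans (le_of_eq (by ring))))
      exact le_of_mul_le_mul_left h1 (by positivity)
    obtain ⟨h1, h2⟩ := abs_modelTrace_le u v w (by omega) hN hs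
    have h3 := hA3 x hx _ hs
    rw [add_sub_cancel] at h3
    exact absurd h3 (not_le.2 (hBR _ h1 h2 _ hy))

/-- Shifting the normalized matrix by `s` times a suitable rank-one projection is possible at an
asymptotic cost `κ N s ^ 2`, the cost being the squared Euclidean norm of the shift of the Gaussian
vector. The projection `Q` depends on `N` only; rank one enters through its trace and its
Hilbert–Schmidt norm. -/
def HasSpikeCost (u v w : ℂ) (κ : ℝ) : Prop :=
  ∀ κ' > κ, ∀ᶠ N : ℕ in atTop, ∃ Q : Matrix (Fin N) (Fin N) ℂ,
    IsIdempotentElem Q ∧ Q.trace = 1 ∧ hsNorm Q = 1 ∧ ∀ s : ℝ, ∃ g : Fin N × Fin N → ℝ,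
      modelMatrix u v w g = (s : ℂ) • Q ∧ ∑ k, g k ^ 2 ≤ κ' * N * s ^ 2

/-- Lower bound for neighbourhoods of the traces reached by a rank-one shift. -/
theorem eventually_le_measure_modelTrace {u v w₀ τ w : ℂ} (h : IsEnsembleCoeff u v w₀ τ) {κ : ℝ}
    (hκ : HasSpikeCost u v w κ) {p : ℕ} (hp : 3 ≤ p) (s : ℝ) {ε : ℝ} (hε : 0 < ε)
    {B : Set ℝ} (hB : MeasurableSet B)
    (hBs : ∀ y, |y - (semicircleMoment p + s ^ p)| ≤ ε → y ∈ B) {κ' : ℝ} (hκ' : κ < κ') :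
    ∀ᶠ N : ℕ in atTop, 1 / 4 * Real.exp (-(κ' * s ^ 2 * (N : ℝ) ^ (1 + 2 / (p : ℝ))) / 2) ≤
      (Measure.pi fun _ : Fin N × Fin N => gaussianReal 0 1).real
        {g | modelTrace u v w p N g ∈ B} := by
  filter_upwards [eventually_exists_typical_set_translate h w hp (abs_nonneg s) hε, hκ κ' hκ',
    eventually_ge_atTop 1] with N ⟨A, hA, hA2, hA3⟩ ⟨Q, hQ, hQtr, hQhs, hQs⟩ hN
  have hN0 : (0 : ℝ) < N := by exact_mod_cast hN
  have hp0 : (p : ℝ) ≠ 0 := by positivity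
  obtain ⟨g, hg, hg2⟩ := hQs (s * (N : ℝ) ^ (1 / (p : ℝ)))
  have hpow : (N : ℝ) ^ (1 + 2 / (p : ℝ)) = N * ((N : ℝ) ^ (1 / (p : ℝ))) ^ 2 := by
    rw [Real.rpow_add hN0, Real.rpow_one, ← Real.rpow_natCast ((N : ℝ) ^ _),
      ← Real.rpow_mul hN0.le]
    congr 2
    push_cast
    ring
  have hs : hsNorm (modelMatrix u v w g) ≤ |s| * (N : ℝ) ^ (1 / (p : ℝ)) := by
    rw [hg, hsNorm_smul, hQhs, mul_one, Complex.norm_real, Real.norm_eq_abs, abs_mul,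
      abs_of_nonneg (by positivity : 0 ≤ (N : ℝ) ^ (1 / (p : ℝ)))]
  have htr : modelTrace u v w p N g = s ^ p := by
    rw [modelTrace_eq, hg, smul_pow, hQ.pow_eq (by omega), Matrix.trace_smul, hQtr, smul_eq_mul,
      mul_one, ← Complex.ofReal_pow, Complex.ofReal_re, mul_pow, ← Real.rpow_natCast (_ ^ _),
      ← Real.rpow_mul hN0.le, one_div_mul_cancel hp0, Real.rpow_one]
    field_simp
  refine le_trans ?_ (gaussian_measure_ge_of_translate g hA
    ((measurable_modelTrace u v w p N) hB) hA2 fun x hx => hBs _ ?_)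
  · gcongr
    rw [hpow]
    refine hg2.trans (le_of_eq (by ring))
  · rw [← htr]
    exact hA3 x hx g hs

/-- The spike on the first diagonal entry. -/
lemma hasSpikeCost_diag (u v : ℂ) {w : ℂ} {a : ℝ} (ha : 0 < a) (hw : w + conj w = a) :
    HasSpikeCost u v w (1 / a ^ 2) := by
  intro κ' hκ'
  filter_upwards [eventually_ge_atTop 1] with N hN
  have hN0 : (0 : ℝ) < N := by exact_mod_cast hN
  obtain ⟨n, rfl⟩ : ∃ n, N = n + 1 := ⟨N - 1, by omega⟩
  refine ⟨Matrix.single 0 0 1, ?_, ?_, ?_,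
    fun s => ⟨Pi.single (0, 0) (√(n + 1 : ℕ) * s / a), ?_, ?_⟩⟩
  · simp [IsIdempotentElem]
  · simp
  · rw [hsNorm, Real.sqrt_eq_one, Finset.sum_eq_single 0, Finset.sum_eq_single 0]
    · simp
    · intro j _ hj; simp [Matrix.single, hj.symm]
    · simp
    · intro j _ hj; simp [Matrix.single, hj.symm]
    · simp
  · have ha' : (a : ℂ) ≠ 0 := by exact_mod_cast ha.ne'
    have hN' : ((√(n + 1 : ℕ) : ℝ) : ℂ) ≠ 0 := by
      exact_mod_cast (Real.sqrt_pos.2 hN0).ne'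
    ext i j
    by_cases hij : i = 0 ∧ j = 0
    · obtain ⟨rfl, rfl⟩ := hij
      simp only [modelMatrix, gaussianMatrix, entryCoeff, Matrix.smul_apply, Matrix.of_apply,
        lt_irrefl, if_false, Pi.single_eq_same, Matrix.single_apply_same, smul_eq_mul,
        ← add_mul, hw]
      push_cast at hN' ⊢
      field_simp
    · have hji : ¬ (j = 0 ∧ i = 0) := fun h => hij h.symm
      have h3 : ¬ (0 = i ∧ 0 = j) := fun h => hij ⟨h.1.symm, h.2.symm⟩
      simp [modelMatrix, gaussianMatrix, Pi.single_apply, hij, hji, Matrix.single, h3]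
  · rw [Finset.sum_eq_single (0, 0)]
    · rw [Pi.single_eq_same, div_pow, mul_pow, Real.sq_sqrt hN0.le]
      calc ((n + 1 : ℕ) : ℝ) * s ^ 2 / a ^ 2 = 1 / a ^ 2 * (n + 1 : ℕ) * s ^ 2 := by ring
        _ ≤ _ := by gcongr
    · intro k _ hk; simp [hk]
    · simp

/-- The spike in the direction of the constant vector. Each off-diagonal entry is produced by a
single Gaussian variable, the one above the diagonal, with `θ` in place of the entry `1`; the
diagonal contributes a vanishing proportion of the cost. -/
lemma hasSpikeCost_const {u w : ℂ} (v : ℂ) {a θ : ℝ} (ha : 0 < a) (hw : w + conj w = a)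
    (hu : u * θ = 1) : HasSpikeCost u v w (θ ^ 2 / 2) := by
  intro κ' hκ'
  have hlim := (tendsto_const_div_atTop_nhds_zero_nat (1 / a ^ 2)).eventually_le_const
    (sub_pos.2 hκ')
  filter_upwards [eventually_ge_atTop 1, hlim] with N hN hlim
  have hN0 : (0 : ℝ) < N := by exact_mod_cast hN
  have hNc : (N : ℂ) ≠ 0 := by exact_mod_cast hN0.ne'
  have ha' : (a : ℂ) ≠ 0 := by exact_mod_cast ha.ne'
  have hN' : ((√N : ℝ) : ℂ) ≠ 0 := by exact_mod_cast (Real.sqrt_pos.2 hN0).ne'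
  refine ⟨Matrix.of fun _ _ => 1 / (N : ℂ), ?_, ?_, ?_, fun s =>
    ⟨fun k => √N * s / N * (if k.1 < k.2 then θ else if k.1 = k.2 then 1 / a else 0), ?_, ?_⟩⟩
  · ext i j
    simp [Matrix.mul_apply, hNc]
  · simp [Matrix.trace, hNc]
  · rw [hsNorm, Real.sqrt_eq_one]
    simp
    field_simp
  · have hu' : conj u * θ = 1 := by
      have := congrArg conj hu
      simpa using this
    ext i j
    simp only [modelMatrix, gaussianMatrix, entryCoeff, Matrix.smul_apply, Matrix.of_apply,
      smul_eq_mul]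
    rcases lt_trichotomy i j with h | rfl | h
    · simp only [h, h.not_gt, h.ne', if_true, if_false]
      push_cast
      field_simp
      linear_combination (s : ℂ) * hu
    · simp only [lt_irrefl, if_true, if_false, ← add_mul, hw]
      push_cast
      field_simp
    · simp only [h, h.not_gt, h.ne', if_true, if_false]
      push_cast
      field_simp
      linear_combination (s : ℂ) * hu'
  · have e1 : ∀ i j : Fin N, (if i < j then θ else if i = j then 1 / a else 0) ^ 2 =
        θ ^ 2 * (if i < j then 1 else 0) + 1 / a ^ 2 * (if i = j then 1 else 0) := by
      intro i j
      rcases lt_trichotomy i j with h | rfl | h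
      · simp [h, h.ne]
      · simp
      · simp [h.not_gt, h.ne']
    have e2 : ∑ i : Fin N, ∑ j : Fin N, (if i < j then (1 : ℝ) else 0) ≤ N ^ 2 / 2 := by
      have hc : ∑ i : Fin N, ∑ j : Fin N, (if j < i then (1 : ℝ) else 0) =
        ∑ i : Fin N, ∑ j : Fin N, (if i < j then (1 : ℝ) else 0) := Finset.sum_comm
      have hle : ∑ i : Fin N, ∑ j : Fin N,
          ((if i < j then (1 : ℝ) else 0) + (if j < i then 1 else 0)) ≤
          ∑ i : Fin N, ∑ j : Fin N, 1 := by
        refine Finset.sum_le_sum fun i _ => Finset.sum_le_sum fun j _ => ?_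
        rcases lt_trichotomy i j with h | rfl | h
        · simp [h, h.not_gt]
        · simp
        · simp [h, h.not_gt]
      simp only [Finset.sum_add_distrib, hc, Finset.sum_const, Finset.card_univ, Fintype.card_fin,
        nsmul_eq_mul, mul_one] at hle
      nlinarith
    rw [Fintype.sum_prod_type]
    simp only [mul_pow, div_pow, e1, ← Finset.mul_sum, Finset.sum_add_distrib, Real.sq_sqrt hN0.le]
    rw [show ∑ i : Fin N, ∑ j : Fin N, (if i = j then (1 : ℝ) else 0) = N by simp]
    calc N * s ^ 2 / N ^ 2 *
          (θ ^ 2 * (∑ i : Fin N, ∑ j : Fin N, (if i < j then (1 : ℝ) else 0)) + 1 / a ^ 2 * N)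
        ≤ N * s ^ 2 / N ^ 2 * (θ ^ 2 * (N ^ 2 / 2) + 1 / a ^ 2 * N) := by gcongr
      _ = (θ ^ 2 / 2 + 1 / a ^ 2 / N) * N * s ^ 2 := by field_simp
      _ ≤ κ' * N * s ^ 2 := by gcongr; linarith

/-! ### The rate function -/

lemma rpow_two_div_le_sq_iff {p : ℕ} (hp : p ≠ 0) {y R : ℝ} (hy : 0 ≤ y) (hR : 0 ≤ R) :
    y ^ (2 / (p : ℝ)) ≤ R ^ 2 ↔ y ≤ R ^ p := by
  have h1 : y ^ (2 / (p : ℝ)) = (y ^ (1 / (p : ℝ))) ^ 2 := by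
    rw [← Real.rpow_natCast (y ^ _), ← Real.rpow_mul hy]
    congr 1
    push_cast
    ring
  have h2 : y = (y ^ (1 / (p : ℝ))) ^ p := by
    rw [one_div, Real.rpow_inv_natCast_pow hy hp]
  have h0 : 0 ≤ y ^ (1 / (p : ℝ)) := by positivity
  rw [h1, pow_le_pow_iff_left₀ h0 hR two_ne_zero]
  conv_rhs => rw [h2]
  rw [pow_le_pow_iff_left₀ h0 hR hp]

open Classical in
lemma rateFunction_eq (σ : ℝ) (β p : ℕ) (x : ℝ) : rateFunction σ β p x =
    if Even p → 0 ≤ x - semicircleMoment p then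
      ENNReal.ofReal (1 / 2 * min (1 / σ ^ 2) ((β : ℝ) / 2) *
        |x - semicircleMoment p| ^ (2 / (p : ℝ)))
    else ⊤ := by
  unfold rateFunction semicircleMoment
  by_cases hp : Even p
  · simp only [hp, if_true, forall_const, sub_nonneg]
    split_ifs with h
    · rw [abs_of_nonneg (sub_nonneg.2 h)]
    · rfl
  · simp [hp]

/-- The level sets of the rate function are the values reached by shifts of bounded cost. -/
lemma rateFunction_le_iff {σ : ℝ} {β p : ℕ} (hp : p ≠ 0)
    (hκ : 0 < min (1 / σ ^ 2) ((β : ℝ) / 2)) (ℓ : ℝ≥0) (x : ℝ) :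
    rateFunction σ β p x ≤ ℓ ↔
      |x - semicircleMoment p| ≤ √(2 * ℓ / min (1 / σ ^ 2) ((β : ℝ) / 2)) ^ p ∧
        (Even p → 0 ≤ x - semicircleMoment p) := by
  classical
  rw [rateFunction_eq]
  split_ifs with h
  · rw [← ENNReal.ofReal_coe_nnreal, ENNReal.ofReal_le_ofReal_iff ℓ.coe_nonneg,
      ← rpow_two_div_le_sq_iff hp (abs_nonneg _) (Real.sqrt_nonneg _),
      Real.sq_sqrt (by positivity), le_div_iff₀ hκ, and_iff_left h]
    constructor <;> intro h <;> linarith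
  · exact iff_of_false (by simp) fun h' => h h'.2

lemma isCompact_rateFunction_le {σ : ℝ} {β p : ℕ} (hp : p ≠ 0)
    (hκ : 0 < min (1 / σ ^ 2) ((β : ℝ) / 2)) (ℓ : ℝ≥0) :
    IsCompact {x | rateFunction σ β p x ≤ ℓ} := by
  simp only [rateFunction_le_iff hp hκ]
  set R := √(2 * ℓ / min (1 / σ ^ 2) ((β : ℝ) / 2)) ^ p
  have h1 : {x : ℝ | |x - semicircleMoment p| ≤ R ∧ (Even p → 0 ≤ x - semicircleMoment p)} =
      Metric.closedBall (semicircleMoment p : ℝ) R ∩ {x | Even p → 0 ≤ x - semicircleMoment p} := by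
    ext x
    simp [Real.dist_eq]
  rw [h1]
  refine (isCompact_closedBall _ _).inter_right ?_
  by_cases h : Even p
  · simp only [h, forall_const]
    exact isClosed_le continuous_const (by fun_prop)
  · simp [h]

/-- Where the rate function is finite, it is the cost of a spike `s` whose `p`-th power reaches the
given value. -/
lemma exists_pow_eq_of_rateFunction_ne_top {σ : ℝ} {β p : ℕ} (hp : p ≠ 0) {x : ℝ}
    (hx : rateFunction σ β p x ≠ ⊤) :
    ∃ s : ℝ, s ^ p = x - semicircleMoment p ∧
      rateFunction σ β p x = ENNReal.ofReal (min (1 / σ ^ 2) ((β : ℝ) / 2) / 2 * s ^ 2) := by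
  classical
  rw [rateFunction_eq] at hx ⊢
  split_ifs at hx ⊢ with h
  swap
  · exact absurd rfl hx
  set y := x - semicircleMoment p
  have h1 : |y| ^ (2 / (p : ℝ)) = (|y| ^ (1 / (p : ℝ))) ^ 2 := by
    rw [← Real.rpow_natCast (|y| ^ _), ← Real.rpow_mul (abs_nonneg y)]
    congr 1
    push_cast
    ring
  have h2 : (|y| ^ (1 / (p : ℝ))) ^ p = |y| := by
    rw [one_div, Real.rpow_inv_natCast_pow (abs_nonneg y) hp]
  rcases le_or_gt 0 y with hy | hy
  · refine ⟨|y| ^ (1 / (p : ℝ)), by rw [h2, abs_of_nonneg hy], ?_⟩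
    rw [h1]; congr 1; ring
  · have hodd : Odd p := Nat.not_even_iff_odd.1 fun hp => hy.not_ge (h hp)
    refine ⟨-|y| ^ (1 / (p : ℝ)), by rw [hodd.neg_pow, h2, abs_of_neg hy, neg_neg], ?_⟩
    rw [h1, neg_sq]; congr 1; ring

/-! ### From exponential bounds to the large deviations principle -/

lemma tendsto_one_div_mul_log_sub {v : ℕ → ℝ} (hv : Tendsto v atTop atTop) (C ℓ : ℝ) :
    Tendsto (fun N => ((1 / v N * (Real.log C - ℓ * v N) : ℝ) : EReal)) atTop
      (𝓝 ((-ℓ : ℝ) : EReal)) := by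
  refine (continuous_coe_real_ereal.tendsto _).comp ?_
  have h1 : Tendsto (fun N => Real.log C * (v N)⁻¹ - ℓ) atTop (𝓝 (Real.log C * 0 - ℓ)) :=
    (hv.inv_tendsto_atTop.const_mul _).sub_const _
  rw [mul_zero, zero_sub] at h1
  refine h1.congr' ?_
  filter_upwards [hv.eventually_gt_atTop 0] with N hN
  field_simp

lemma coe_mul_log_ofReal {C x a : ℝ} (hC : 0 < C) :
    (a : EReal) * ENNReal.log (ENNReal.ofReal (C * Real.exp (-x))) =
      ((a * (Real.log C - x) : ℝ) : EReal) := by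
  rw [ENNReal.log_ofReal_of_pos (by positivity), Real.log_mul hC.ne' (Real.exp_ne_zero _),
    Real.log_exp, EReal.coe_mul, sub_eq_add_neg]

lemma limsup_log_le_of_eventually_le {v : ℕ → ℝ} (hv : Tendsto v atTop atTop) {m : ℕ → ℝ≥0∞}
    {C ℓ : ℝ} (hC : 0 < C)
    (hm : ∀ᶠ N in atTop, m N ≤ ENNReal.ofReal (C * Real.exp (-(ℓ * v N)))) :
    limsup (fun N => ((1 / v N : ℝ) : EReal) * ENNReal.log (m N)) atTop ≤ ((-ℓ : ℝ) : EReal) := by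
  rw [← (tendsto_one_div_mul_log_sub hv C ℓ).limsup_eq]
  refine limsup_le_limsup ?_
  filter_upwards [hm, hv.eventually_gt_atTop 0] with N hN hv0
  rw [← coe_mul_log_ofReal hC]
  exact mul_le_mul_of_nonneg_left (ENNReal.log_le_log hN)
    (EReal.coe_nonneg.2 (by positivity))

lemma le_liminf_log_of_eventually_le {v : ℕ → ℝ} (hv : Tendsto v atTop atTop) {m : ℕ → ℝ≥0∞}
    {C ℓ : ℝ} (hC : 0 < C)
    (hm : ∀ᶠ N in atTop, ENNReal.ofReal (C * Real.exp (-(ℓ * v N))) ≤ m N) :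
    ((-ℓ : ℝ) : EReal) ≤ liminf (fun N => ((1 / v N : ℝ) : EReal) * ENNReal.log (m N)) atTop := by
  rw [← (tendsto_one_div_mul_log_sub hv C ℓ).liminf_eq]
  refine liminf_le_liminf ?_
  filter_upwards [hm, hv.eventually_gt_atTop 0] with N hN hv0
  rw [← coe_mul_log_ofReal hC]
  exact mul_le_mul_of_nonneg_left (ENNReal.log_le_log hN)
    (EReal.coe_nonneg.2 (by positivity))

/-- The large deviations upper bound follows from bounds at every level below the infimum. -/
lemma le_neg_coe_of_forall_lt {L : EReal} {I : ℝ≥0∞} (h0 : L ≤ 0)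
    (h : ∀ ℓ : ℝ≥0, (ℓ : ℝ≥0∞) < I → L ≤ ((-(ℓ : ℝ) : ℝ) : EReal)) : L ≤ -(I : EReal) := by
  rw [EReal.le_neg]
  have h1 : I ≤ (-L).toENNReal := by
    refine le_of_forall_lt fun c hc => ?_
    obtain ⟨ℓ, hcl, hl⟩ := ENNReal.lt_iff_exists_nnreal_btwn.1 hc
    refine hcl.trans_le ?_
    have h2 := h ℓ hl
    rw [EReal.coe_neg, EReal.le_neg] at h2
    have h3 := EReal.toENNReal_le_toENNReal h2
    rwa [show ((ℓ : ℝ) : EReal) = ((ℓ : ℝ≥0∞) : EReal) from rfl, EReal.toENNReal_coe] at h3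
  have h2 := EReal.coe_ennreal_le_coe_ennreal_iff.2 h1
  rwa [EReal.coe_toENNReal (EReal.neg_nonneg.2 h0)] at h2

/-- The large deviations lower bound follows from the bound at every point. -/
lemma neg_coe_iInf_le_of_forall {𝓧 : Type*} {J : 𝓧 → ℝ≥0∞} {S : Set 𝓧} {L : EReal}
    (h : ∀ x ∈ S, -(J x : EReal) ≤ L) : -((⨅ x ∈ S, J x : ℝ≥0∞) : EReal) ≤ L := by
  rw [EReal.neg_le]
  have h1 : (-L).toENNReal ≤ ⨅ x ∈ S, J x := by
    refine le_iInf₂ fun x hx => ?_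
    have h2 := h x hx
    rw [EReal.neg_le] at h2
    have h3 := EReal.toENNReal_le_toENNReal h2
    rwa [EReal.toENNReal_coe] at h3
  refine le_trans ?_ (EReal.coe_ennreal_le_coe_ennreal_iff.2 h1)
  rw [EReal.coe_toENNReal_eq_max]
  exact le_max_right _ _

lemma tendsto_natCast_rpow_speed (p : ℕ) :
    Tendsto (fun N : ℕ => (N : ℝ) ^ (1 + 2 / (p : ℝ))) atTop atTop :=
  (tendsto_rpow_atTop (by positivity)).comp tendsto_natCast_atTop_atTop

/-- The large deviations principle, for all the ensembles at once. -/
theorem satisfiesLDP_of_model {Ω : Type*} [MeasurableSpace Ω] {P : Measure Ω}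
    [IsProbabilityMeasure P] {X : ℕ → ℕ → Ω → ℂ} (hX : IsWigner P X) {p β : ℕ} {σ : ℝ} (hp : 3 ≤ p)
    {u v w w₀ τ : ℂ} (h : IsEnsembleCoeff u v w₀ τ)
    (hoff : P.map (X 0 1) = ((gaussianReal 0 1).prod (gaussianReal 0 1)).map
        fun z : ℝ × ℝ => u * (z.1 : ℂ) + v * (z.2 : ℂ))
    (hdiag : P.map (X 0 0) = (gaussianReal 0 1).map fun x : ℝ => (w + conj w) * (x : ℂ))
    (hκ : 0 < min (1 / σ ^ 2) ((β : ℝ) / 2))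
    (hκoff : ∀ a b : ℝ, 2 * min (1 / σ ^ 2) ((β : ℝ) / 2) * ‖u * a + v * b‖ ^ 2 ≤ a ^ 2 + b ^ 2)
    (hκdiag : min (1 / σ ^ 2) ((β : ℝ) / 2) * ‖w + conj w‖ ^ 2 ≤ 1)
    (hκspike : HasSpikeCost u v w (min (1 / σ ^ 2) ((β : ℝ) / 2))) :
    SatisfiesLDP P (fun N => traceMoment X p N) (fun N => (N : ℝ) ^ (1 + 2 / (p : ℝ)))
        (rateFunction σ β p) ∧ IsGoodRateFunction (rateFunction σ β p) := by
  have hp0 : p ≠ 0 := by omega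
  have hcpt := isCompact_rateFunction_le (σ := σ) (β := β) hp0 hκ
  have hJ : IsRateFunction (rateFunction σ β p) := fun t => (hcpt t).isClosed
  have hv := tendsto_natCast_rpow_speed p
  have hlaw := fun N => (measure_traceMoment_eq hX hoff hdiag p N).2
  refine ⟨⟨fun N => (measure_traceMoment_eq hX hoff hdiag p N).1, hJ, ?_, hv, ?_, ?_⟩, hJ, hcpt⟩
  · intro m n hmn
    have : (m : ℝ) ≤ n := by exact_mod_cast hmn
    exact Real.rpow_le_rpow (by positivity) this (by positivity)
  · intro B hB
    simp only [hlaw _ B hB]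
    refine neg_coe_iInf_le_of_forall fun x hx => ?_
    by_cases hxt : rateFunction σ β p x = ⊤
    · simp [hxt]
    obtain ⟨s, hs, hxs⟩ := exists_pow_eq_of_rateFunction_ne_top hp0 hxt
    obtain ⟨ε, hε, hball⟩ := Metric.nhds_basis_closedBall.mem_iff.1 (mem_interior_iff_mem_nhds.1 hx)
    set κ := min (1 / σ ^ 2) ((β : ℝ) / 2)
    rw [hxs, EReal.coe_ennreal_ofReal, max_eq_left (by positivity), ← EReal.coe_neg]
    have hlim : Tendsto (fun κ' : ℝ => ((-(κ' / 2 * s ^ 2) : ℝ) : EReal)) (𝓝[>] κ)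
        (𝓝 ((-(κ / 2 * s ^ 2) : ℝ) : EReal)) :=
      ((continuous_coe_real_ereal.comp (by fun_prop)).tendsto κ).mono_left nhdsWithin_le_nhds
    refine le_of_tendsto hlim (eventually_mem_nhdsWithin.mono fun κ' hκ' => ?_)
    refine le_liminf_log_of_eventually_le hv (C := 1 / 4) (by norm_num) ?_
    have hBs : ∀ y, |y - (semicircleMoment p + s ^ p)| ≤ ε → y ∈ B := fun y hy => by
      rw [hs, add_sub_cancel] at hy
      exact hball (by simpa [Real.dist_eq] using hy)
    filter_upwards [eventually_le_measure_modelTrace h hκspike hp s hε hB hBs hκ'] with N hN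
    rw [← ofReal_measureReal]
    refine ENNReal.ofReal_le_ofReal (le_trans (le_of_eq ?_) hN)
    congr 2
    ring
  · intro B hB
    simp only [hlaw _ B hB]
    set κ := min (1 / σ ^ 2) ((β : ℝ) / 2) with hκdef
    refine le_neg_coe_of_forall_lt ?_ fun ℓ hℓ => ?_
    · refine (limsup_le_limsup (v := fun _ => (0 : EReal)) (.of_forall fun N => ?_)).trans
        (by simp)
      have h1 : ENNReal.log ((Measure.pi fun _ : Fin N × Fin N => gaussianReal 0 1)
          {g | modelTrace u v w p N g ∈ B}) ≤ 0 := by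
        rw [← ENNReal.log_one]
        exact ENNReal.log_le_log prob_le_one
      have h2 : (0 : EReal) ≤ ((1 / (N : ℝ) ^ (1 + 2 / (p : ℝ)) : ℝ) : EReal) :=
        EReal.coe_nonneg.2 (by positivity)
      simpa using mul_le_mul_of_nonneg_left h1 h2
    -- the level set at `ℓ` is compact and disjoint from `closure B`
    have hsub : {x | rateFunction σ β p x ≤ ℓ} ⊆ (closure B)ᶜ := fun x hx hxB =>
      (hℓ.trans_le ((iInf₂_le x hxB).trans hx)).false
    obtain ⟨δ, hδ, hthick⟩ := (hcpt ℓ).exists_thickening_subset_open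
      isClosed_closure.isOpen_compl hsub
    set R := √(2 * ℓ / κ) with hR
    have hR2 : κ * R ^ 2 = 2 * ℓ := by
      rw [hR, Real.sq_sqrt (by positivity)]
      field_simp
    have hBR : ∀ s, |s| ≤ R ^ p → (Even p → 0 ≤ s) → ∀ y ∈ B,
        δ / 2 < |y - (semicircleMoment p + s)| := by
      intro s hs1 hs2 y hy
      have hmem : rateFunction σ β p (semicircleMoment p + s) ≤ ℓ := by
        rw [rateFunction_le_iff hp0 hκ, add_sub_cancel_left]
        exact ⟨hs1, hs2⟩
      by_contra! hlt
      refine hthick (Metric.mem_thickening_iff.2 ⟨_, hmem, ?_⟩) (subset_closure hy)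
      rw [Real.dist_eq]
      linarith
    have hlim : Tendsto (fun t : ℝ => ((-((1 - t) * ℓ) : ℝ) : EReal)) (𝓝[>] 0)
        (𝓝 ((-((1 - 0) * ℓ) : ℝ) : EReal)) :=
      ((continuous_coe_real_ereal.comp (by fun_prop)).tendsto (0 : ℝ)).mono_left nhdsWithin_le_nhds
    rw [sub_zero, one_mul] at hlim
    refine ge_of_tendsto hlim ?_
    filter_upwards [Ioo_mem_nhdsGT one_pos] with t ht
    refine limsup_log_le_of_eventually_le hv (C := 2 ^ ((1 - t) / t)) (by positivity) ?_
    filter_upwards [eventually_measure_modelTrace_le h hκ hκoff hκdiag hp (Real.sqrt_nonneg _)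
      (half_pos hδ) hB hBR ht.1 ht.2] with N hN
    refine hN.trans (le_of_eq ?_)
    rw [← hR, hR2]
    congr 3
    ring

/-- The real symmetric ensemble, with diagonal entries of variance `2`. -/
lemma isEnsembleCoeff_real : IsEnsembleCoeff 1 0 (1 / √2 : ℂ) 1 := by
  have h : ((√2 : ℝ) : ℂ) * ((√2 : ℝ) : ℂ) = 2 := by
    rw [← Complex.ofReal_mul, Real.mul_self_sqrt (by norm_num)]; norm_num
  have h0 : ((√2 : ℝ) : ℂ) ≠ 0 := by
    intro h0; rw [h0] at h; norm_num at h
  constructor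
  · simp
  · simp only [map_div₀, map_one, Complex.conj_ofReal]
    field_simp
    linear_combination -h
  · simp
  · simp only [map_div₀, map_one, Complex.conj_ofReal]
    field_simp
    linear_combination -h
  · simp
  · right
    simp

/-- The complex Hermitian ensemble, with diagonal entries of variance `1`. -/
lemma isEnsembleCoeff_complex :
    IsEnsembleCoeff (1 / √2 : ℂ) (Complex.I / √2) ((1 + Complex.I) / 2) 0 := by
  have h : ((√2 : ℝ) : ℂ) * ((√2 : ℝ) : ℂ) = 2 := by
    rw [← Complex.ofReal_mul, Real.mul_self_sqrt (by norm_num)]; norm_num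
  have h0 : ((√2 : ℝ) : ℂ) ≠ 0 := by
    intro h0; rw [h0] at h; norm_num at h
  have hI := Complex.I_mul_I
  constructor
  · simp only [map_div₀, map_one, Complex.conj_ofReal, Complex.conj_I]
    field_simp
    linear_combination -h - hI
  · simp only [map_div₀, map_add, map_one, Complex.conj_I, map_ofNat]
    linear_combination -hI / 2
  · field_simp
    linear_combination hI
  · simp only [map_div₀, map_add, map_one, Complex.conj_I, map_ofNat]
    linear_combination hI / 2
  · simp
  · left; rfl

end GaussianTraceLDP

theorem theorem1p2 {Ω : Type*} [MeasurableSpace Ω] (P : Measure Ω) [IsProbabilityMeasure P]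
    (X : ℕ → ℕ → Ω → ℂ) (p β : ℕ) (σ : ℝ≥0) (hp : 3 ≤ p) (hσ : 0 < σ)
    (hX : GaussianTraceLDP.IsWigner P X)
    (hdiag : GaussianTraceLDP.IsRealGaussian P (σ ^ 2) (X 0 0))
    (hoffDiag : (β = 1 ∧ GaussianTraceLDP.IsRealGaussian P 1 (X 0 1)) ∨
      (β = 2 ∧ GaussianTraceLDP.IsStdComplexGaussian P (X 0 1))) :
    GaussianTraceLDP.SatisfiesLDP P (fun N => GaussianTraceLDP.traceMoment X p N)
        (fun N => (N : ℝ) ^ (1 + 2 / (p : ℝ))) (GaussianTraceLDP.rateFunction σ β p) ∧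
      GaussianTraceLDP.IsGoodRateFunction (GaussianTraceLDP.rateFunction σ β p) := by
  open GaussianTraceLDP in
  have hσ' : (0 : ℝ) < σ := by exact_mod_cast hσ
  -- the diagonal coefficient of the model is `σ / 2`, since `w + conj w` multiplies the diagonal
  have hw : ((σ : ℝ) / 2 : ℂ) + conj ((σ : ℝ) / 2 : ℂ) = ((σ : ℝ) : ℂ) := by
    simp only [map_div₀, Complex.conj_ofReal, map_ofNat]
    ring
  have hd : P.map (X 0 0) = (gaussianReal 0 1).map
      fun x : ℝ => (((σ : ℝ) / 2 : ℂ) + conj ((σ : ℝ) / 2 : ℂ)) * (x : ℂ) := by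
    rw [hw]
    exact map_diag_of_isRealGaussian hdiag
  have hκdiag : min (1 / (σ : ℝ) ^ 2) ((β : ℝ) / 2) *
      ‖((σ : ℝ) / 2 : ℂ) + conj ((σ : ℝ) / 2 : ℂ)‖ ^ 2 ≤ 1 := by
    rw [hw, Complex.norm_real, Real.norm_eq_abs, sq_abs]
    calc min (1 / (σ : ℝ) ^ 2) ((β : ℝ) / 2) * (σ : ℝ) ^ 2
        ≤ 1 / (σ : ℝ) ^ 2 * (σ : ℝ) ^ 2 := by gcongr; exact min_le_left _ _
      _ = 1 := by field_simp
  rcases hoffDiag with ⟨rfl, h⟩ | ⟨rfl, h⟩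
  · refine satisfiesLDP_of_model hX hp isEnsembleCoeff_real (map_off_of_isRealGaussian h) hd
      (lt_min (by positivity) (by norm_num)) (fun a b => ?_) hκdiag ?_
    · have h1 : min (1 / (σ : ℝ) ^ 2) (((1 : ℕ) : ℝ) / 2) ≤ 1 / 2 := by simp
      rw [one_mul, zero_mul, add_zero, Complex.norm_real, Real.norm_eq_abs, sq_abs]
      nlinarith [mul_le_mul_of_nonneg_right h1 (sq_nonneg a), sq_nonneg b]
    · rcases min_cases (1 / (σ : ℝ) ^ 2) (((1 : ℕ) : ℝ) / 2) with h1 | h1 <;> rw [h1.1]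
      · exact hasSpikeCost_diag _ _ hσ' hw
      · simpa using hasSpikeCost_const (u := 1) (θ := 1) 0 hσ' hw (by simp)
  · have h2 : ((√2 : ℝ) : ℂ) ≠ 0 := by
      exact_mod_cast (Real.sqrt_pos.2 (by norm_num : (0 : ℝ) < 2)).ne'
    refine satisfiesLDP_of_model hX hp isEnsembleCoeff_complex (map_off_of_isStdComplexGaussian h)
      hd (lt_min (by positivity) (by norm_num)) (fun a b => ?_) hκdiag ?_
    · have h1 : min (1 / (σ : ℝ) ^ 2) (((2 : ℕ) : ℝ) / 2) ≤ 1 := by simp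
      have h3 : ‖(1 / √2 : ℂ) * a + (Complex.I / √2) * b‖ ^ 2 = (a ^ 2 + b ^ 2) / 2 := by
        rw [show (1 / √2 : ℂ) * a + (Complex.I / √2) * b = (a + b * Complex.I) / (√2 : ℂ) by ring,
          norm_div, div_pow, Complex.norm_add_mul_I, Complex.norm_real, Real.norm_eq_abs, sq_abs,
          Real.sq_sqrt (by positivity), Real.sq_sqrt (by norm_num)]
      rw [h3]
      nlinarith [mul_le_mul_of_nonneg_right h1 (add_nonneg (sq_nonneg a) (sq_nonneg b))]
    · rcases min_cases (1 / (σ : ℝ) ^ 2) (((2 : ℕ) : ℝ) / 2) with h1 | h1 <;> rw [h1.1]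
      · exact hasSpikeCost_diag _ _ hσ' hw
      · simpa using hasSpikeCost_const (u := 1 / √2) (θ := √2) (Complex.I / √2) hσ' hw
          (by field_simp)
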